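/- Let $\mathbb T=\{z\in\mathbb C:|z|=1\}$ with normalised Lebesgue measure $\mathrm m$. For $\alpha\in\mathbb R$ let $\mathbb A_\alpha$ be the noncommutative 2-torus, i.e. the universal unital $C^*$-algebra generated by two unitaries $U,V$ subject to $UV=e^{2\pi i\alpha}VU$, and let $\tau$ be its canonical trace, the state with $\tau(U^mV^n)=\delta_{m,0}\delta_{n,0}$ for $m,n\in\mathbb Z$. Let $f:\mathbb T\to\mathbb T$ be continuous and let $\theta\in\mathbb R$ be such that $\theta/2\pi$ is irrational. The Anzai skew-product $\Phi_{\theta,f}$ is the $*$-automorphism of $\mathbb A_\alpha$ determined by $\Phi_{\theta,f}(U)=e^{i\theta}U$ and $\Phi_{\theta,f}(V)=f(U)V$. Write $R_a z=e^{2\pi i a}z$ and put $$f_n=\prod_{l=0}^{n-1}f\circ R_{-l\alpha}\ (n>0),\qquad f_0=1,\qquad f_n=\prod_{l=1}^{|n|}\overline{f\circ R_{l\alpha}}\ (n<0).$$ Then the following are equivalent: (i) $\tau$ is ergodic for $\Phi_{\theta,f}$, i.e. $\tau$ is an extreme point of the convex set of $\Phi_{\theta,f}$-invariant states of $\mathbb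 A_\alpha$; (ii) for each $n\in\mathbb Z\setminus\{0\}$ the cohomological equation $(g\circ R_{\theta/2\pi})\,f_n=g$ (almost everywhere) has no nonzero solution $g\in L^2(\mathbb T,\mathrm m)$; (iii) $(\mathbb A_\alpha,\Phi_{\theta,f})$ is uniquely ergodic, i.e. there is exactly one $\Phi_{\theta,f}$-invariant state on $\mathbb A_\alpha$. -/

import Mathlib

noncomputable section
open scoped ComplexOrder

/-- The free unital complex `*`-algebra on two unitary indeterminates: the group algebra of the free
group on two generators, with `(a g)^* = conj a g⁻¹`. -/
def PreTorus (_α : ℝ) : Type := MonoidAlgebra ℂ (FreeGroup Bool)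

namespace PreTorus

variable (α : ℝ)

instance : Ring (PreTorus α) := inferInstanceAs (Ring (MonoidAlgebra ℂ (FreeGroup Bool)))
instance : Algebra ℂ (PreTorus α) :=
  inferInstanceAs (Algebra ℂ (MonoidAlgebra ℂ (FreeGroup Bool)))

/-- The monomial `a g`. -/
def mono (g : FreeGroup Bool) (a : ℂ) : PreTorus α := MonoidAlgebra.single g a

variable {α}

theorem mono_mul_mono (g h : FreeGroup Bool) (a b : ℂ) :
    mono α g a * mono α h b = mono α (g * h) (a * b) :=
  MonoidAlgebra.single_mul_single g h a b

theorem one_def : (1 : PreTorus α) = mono α 1 1 := rfl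

theorem mono_add (g : FreeGroup Bool) (a b : ℂ) :
    mono α g (a + b) = mono α g a + mono α g b := MonoidAlgebra.single_add g a b

theorem smul_mono (c : ℂ) (g : FreeGroup Bool) (a : ℂ) :
    c • mono α g a = mono α g (c * a) := MonoidAlgebra.smul_single c g a

theorem induction {P : PreTorus α → Prop} (x : PreTorus α) (zero : P 0)
    (add : ∀ x y, P x → P y → P (x + y)) (mono : ∀ g a, P (mono α g a)) : P x :=
  MonoidAlgebra.induction_linear x zero add mono

/-- The involution, as an additive map. -/
def starHom (α : ℝ) : PreTorus α →+ PreTorus α :=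
  MonoidAlgebra.liftNC (R := PreTorus α)
    ((algebraMap ℂ (PreTorus α)).toAddMonoidHom.comp (starAddEquiv (R := ℂ)).toAddMonoidHom)
    (fun g => mono α g⁻¹ 1)

theorem starHom_mono (g : FreeGroup Bool) (a : ℂ) :
    starHom α (mono α g a) = mono α g⁻¹ (star a) := by
  refine (MonoidAlgebra.liftNC_single _ _ g a).trans ?_
  change algebraMap ℂ (PreTorus α) (star a) * mono α g⁻¹ 1 = _
  rw [← Algebra.smul_def, smul_mono, mul_one]

instance : StarRing (PreTorus α) where
  star := starHom α
  star_involutive x := by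
    induction x using induction with
    | zero => simp
    | add x y hx hy => simp [hx, hy]
    | mono g a => simp [starHom_mono]
  star_mul x y := by
    change starHom α (x * y) = starHom α y * starHom α x
    induction x using induction with
    | zero => simp
    | add x x' hx hx' => simp [add_mul, mul_add, hx, hx']
    | mono g a =>
      induction y using induction with
      | zero => simp
      | add y y' hy hy' => simp [add_mul, mul_add, hy, hy']
      | mono h b => simp [starHom_mono, mono_mul_mono, mul_comm]
  star_add x y := map_add (starHom α) x y

theorem star_mono (g : FreeGroup Bool) (a : ℂ) : star (mono α g a) = mono α g⁻¹ (star a) :=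
  starHom_mono g a

instance : StarModule ℂ (PreTorus α) where
  star_smul c x := by
    induction x using induction with
    | zero => simp
    | add x y hx hy => simp only [smul_add, star_add, hx, hy]
    | mono g a => simp [star_mono, smul_mono]

variable (α) in
/-- The first unitary indeterminate. -/
def u : PreTorus α := mono α (FreeGroup.of true) 1

variable (α) in
/-- The second unitary indeterminate. -/
def v : PreTorus α := mono α (FreeGroup.of false) 1

/-- The `C^*`-seminorms on the free `*`-algebra on two unitaries `u`, `v` that are compatible with
the relation `u v = e^{2 π i α} v u`. -/
structure IsCStarSeminorm (p : Seminorm ℂ (PreTorus α)) : Prop where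
  mul_le : ∀ x y, p (x * y) ≤ p x * p y
  star_mul_self : ∀ x, p (star x * x) = p x ^ 2
  relation : p (u α * v α - Complex.exp (2 * Real.pi * Complex.I * α) • (v α * u α)) = 0

theorem IsCStarSeminorm.mono_le {p : Seminorm ℂ (PreTorus α)} (hp : IsCStarSeminorm p)
    (g : FreeGroup Bool) (a : ℂ) : p (mono α g a) ≤ ‖a‖ := by
  have h1 : p (mono α 1 1) ≤ 1 := by
    have := hp.star_mul_self (mono α 1 1)
    simp only [star_mono, mono_mul_mono, inv_one, star_one, mul_one] at this
    nlinarith [apply_nonneg p (mono α 1 1)]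
  have hg : p (mono α g 1) ≤ 1 := by
    have := hp.star_mul_self (mono α g 1)
    simp only [star_mono, mono_mul_mono, inv_mul_cancel, star_one, mul_one] at this
    nlinarith [apply_nonneg p (mono α g 1)]
  have : mono α g a = a • mono α g 1 := by rw [smul_mono, mul_one]
  rw [this, map_smul_eq_mul]
  exact mul_le_of_le_one_right (norm_nonneg a) hg

theorem exists_bound (x : PreTorus α) :
    ∃ C : ℝ, ∀ p : Seminorm ℂ (PreTorus α), IsCStarSeminorm p → p x ≤ C := by
  induction x using induction with
  | zero => exact ⟨0, fun p _ => by simp⟩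
  | add x y hx hy =>
    obtain ⟨C, hC⟩ := hx
    obtain ⟨D, hD⟩ := hy
    exact ⟨C + D, fun p hp => (map_add_le_add p x y).trans (add_le_add (hC p hp) (hD p hp))⟩
  | mono g a => exact ⟨‖a‖, fun p hp => hp.mono_le g a⟩

theorem isCStarSeminorm_zero : IsCStarSeminorm (0 : Seminorm ℂ (PreTorus α)) where
  mul_le := by simp
  star_mul_self := by simp
  relation := by simp

/-- The universal `C^*`-seminorm: the largest `C^*`-seminorm compatible with the relation. -/
instance : Norm (PreTorus α) where
  norm x := ⨆ p : {p : Seminorm ℂ (PreTorus α) // IsCStarSeminorm p}, p.1 x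

theorem norm_def (x : PreTorus α) :
    ‖x‖ = ⨆ p : {p : Seminorm ℂ (PreTorus α) // IsCStarSeminorm p}, p.1 x := rfl

theorem IsCStarSeminorm.le_norm {p : Seminorm ℂ (PreTorus α)} (hp : IsCStarSeminorm p)
    (x : PreTorus α) : p x ≤ ‖x‖ := by
  obtain ⟨C, hC⟩ := exists_bound x
  exact le_ciSup (f := fun p : {p : Seminorm ℂ (PreTorus α) // IsCStarSeminorm p} => p.1 x)
    ⟨C, by rintro _ ⟨q, rfl⟩; exact hC q.1 q.2⟩ ⟨p, hp⟩

theorem norm_le_of {x : PreTorus α} {C : ℝ}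
    (h : ∀ p : Seminorm ℂ (PreTorus α), IsCStarSeminorm p → p x ≤ C) : ‖x‖ ≤ C :=
  haveI : Nonempty {p : Seminorm ℂ (PreTorus α) // IsCStarSeminorm p} :=
    ⟨⟨0, isCStarSeminorm_zero⟩⟩
  ciSup_le fun p => h p.1 p.2

theorem norm_nonneg' (x : PreTorus α) : 0 ≤ ‖x‖ :=
  (apply_nonneg (0 : Seminorm ℂ (PreTorus α)) x).trans (isCStarSeminorm_zero.le_norm x)

instance : SeminormedRing (PreTorus α) :=
  RingSeminorm.toSeminormedRing
    { toFun := fun x => ‖x‖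
      map_zero' := le_antisymm (norm_le_of fun p _ => by simp) (norm_nonneg' 0)
      add_le' := fun x y => norm_le_of fun p hp =>
        (map_add_le_add p x y).trans (add_le_add (hp.le_norm x) (hp.le_norm y))
      neg' := fun x => by simp [norm_def]
      mul_le' := fun x y => norm_le_of fun p hp => (hp.mul_le x y).trans
        (mul_le_mul (hp.le_norm x) (hp.le_norm y) (apply_nonneg p y) (norm_nonneg' x)) }

instance : NormedAlgebra ℂ (PreTorus α) where
  norm_smul_le c x := norm_le_of fun p hp => by
    rw [map_smul_eq_mul]
    exact mul_le_mul_of_nonneg_left (hp.le_norm x) (norm_nonneg c)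

theorem norm_mul_self_le (x : PreTorus α) : ‖x‖ * ‖x‖ ≤ ‖star x * x‖ := by
  have : ‖x‖ ≤ Real.sqrt ‖star x * x‖ := norm_le_of fun p hp =>
    Real.le_sqrt_of_sq_le ((hp.star_mul_self x).symm.le.trans (hp.le_norm _))
  calc ‖x‖ * ‖x‖ ≤ Real.sqrt ‖star x * x‖ * Real.sqrt ‖star x * x‖ :=
        mul_self_le_mul_self (norm_nonneg' x) this
    _ = _ := Real.mul_self_sqrt (norm_nonneg' _)

theorem norm_star_le (x : PreTorus α) : ‖star x‖ ≤ ‖x‖ := by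
  have h := (norm_mul_self_le (star x)).trans (norm_mul_le (star (star x)) (star x))
  rw [star_star] at h
  by_contra hlt
  push Not at hlt
  nlinarith [norm_nonneg' x]

instance : NormedStarGroup (PreTorus α) where
  norm_star_le := norm_star_le

theorem norm_mono_le (g : FreeGroup Bool) (a : ℂ) : ‖mono α g a‖ ≤ ‖a‖ :=
  norm_le_of fun _ hp => hp.mono_le g a

theorem relation_norm :
    ‖u α * v α - Complex.exp (2 * Real.pi * Complex.I * α) • (v α * u α)‖ = 0 :=
  le_antisymm (norm_le_of fun _ hp => hp.relation.le) (norm_nonneg' _)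

end PreTorus

/-- The noncommutative torus `𝔸_α`: the universal unital `C^*`-algebra generated by two unitaries
`U`, `V` with `U V = e^{2 π i α} V U`, as the (separated) completion of the free `*`-algebra on two
unitaries for its universal `C^*`-seminorm. See `NCTorus.lift` and `NCTorus.hom_ext` for the
universal property. -/
def NCTorus (α : ℝ) : Type := UniformSpace.Completion (PreTorus α)

namespace NCTorus
open UniformSpace

variable {α : ℝ}

instance : NormedRing (NCTorus α) := inferInstanceAs (NormedRing (Completion (PreTorus α)))
instance : CompleteSpace (NCTorus α) :=
  inferInstanceAs (CompleteSpace (Completion (PreTorus α)))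
instance instAlgebra : Algebra ℂ (NCTorus α) :=
  inferInstanceAs (Algebra ℂ (Completion (PreTorus α)))
instance : NormedAlgebra ℂ (NCTorus α) where
  __ := instAlgebra
  norm_smul_le c x := norm_smul_le (β := Completion (PreTorus α)) c x
/-- The canonical map from the free `*`-algebra. -/
def mk (x : PreTorus α) : NCTorus α := Completion.coe' x

theorem continuous_mk : Continuous (mk : PreTorus α → NCTorus α) :=
  Completion.continuous_coe _
theorem norm_mk (x : PreTorus α) : ‖mk x‖ = ‖x‖ := Completion.norm_coe x
theorem mk_add (x y : PreTorus α) : mk (x + y) = mk x + mk y := Completion.coe_add x y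
theorem mk_mul (x y : PreTorus α) : mk (x * y) = mk x * mk y := Completion.coe_mul x y
theorem mk_one : mk (1 : PreTorus α) = 1 := rfl
theorem mk_smul (c : ℂ) (x : PreTorus α) : mk (c • x) = c • mk x := Completion.coe_smul c x

theorem denseRange_mk : DenseRange (mk : PreTorus α → NCTorus α) := Completion.denseRange_coe

theorem induction {P : NCTorus α → Prop} (x : NCTorus α) (hc : IsClosed {x | P x})
    (h : ∀ y, P (mk y)) : P x := Completion.induction_on x hc h

/-- The involution, extended by continuity. -/
def starFun (x : NCTorus α) : NCTorus α :=
  Completion.map (star : PreTorus α → PreTorus α) x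

theorem continuous_starFun : Continuous (starFun : NCTorus α → NCTorus α) :=
  Completion.continuous_map

theorem starFun_mk (x : PreTorus α) : starFun (mk x) = mk (star x) :=
  Completion.map_coe (starₗᵢ ℂ : PreTorus α ≃ₗᵢ⋆[ℂ] PreTorus α).isometry.uniformContinuous x

instance : StarRing (NCTorus α) where
  star := starFun
  star_involutive x := by
    induction x using induction with
    | hc => exact isClosed_eq (continuous_starFun.comp continuous_starFun) continuous_id
    | h x => simp [starFun_mk]
  star_mul x y := by
    change starFun (x * y) = starFun y * starFun x
    induction x using induction with
    | hc =>
      exact isClosed_eq (continuous_starFun.comp (continuous_id.mul continuous_const))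
        (continuous_const.mul continuous_starFun)
    | h x =>
      induction y using induction with
      | hc =>
        exact isClosed_eq (continuous_starFun.comp (continuous_const.mul continuous_id))
          (continuous_starFun.mul continuous_const)
      | h y => rw [← mk_mul, starFun_mk, starFun_mk, starFun_mk, star_mul, mk_mul]
  star_add x y := by
    change starFun (x + y) = starFun x + starFun y
    induction x using induction with
    | hc =>
      exact isClosed_eq (continuous_starFun.comp (continuous_id.add continuous_const))
        (continuous_starFun.add continuous_const)
    | h x =>
      induction y using induction with
      | hc =>
        exact isClosed_eq (continuous_starFun.comp (continuous_const.add continuous_id))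
          (continuous_const.add continuous_starFun)
      | h y => rw [← mk_add, starFun_mk, starFun_mk, starFun_mk, star_add, mk_add]

theorem star_mk (x : PreTorus α) : star (mk x) = mk (star x) := starFun_mk x

instance : CStarAlgebra (NCTorus α) where
  norm_mul_self_le x := by
    induction x using induction with
    | hc =>
      exact isClosed_le (continuous_norm.mul continuous_norm)
        (continuous_norm.comp (continuous_starFun.mul continuous_id))
    | h x =>
      rw [star_mk, ← mk_mul, norm_mk, norm_mk]
      exact PreTorus.norm_mul_self_le x
  star_smul c x := by
    induction x using induction with
    | hc =>
      exact isClosed_eq (continuous_starFun.comp (continuous_const_smul c))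
        (continuous_starFun.const_smul (star c))
    | h x => rw [← mk_smul, star_mk, star_mk, ← mk_smul, star_smul]

end NCTorus

namespace PreTorus

variable {α : ℝ} {D : Type*} [CStarAlgebra D]

/-- The unital homomorphism from the free `*`-algebra on two unitaries determined by a pair of
unitaries of `D`. -/
def liftAlgHom (α : ℝ) (a b : unitary D) : PreTorus α →ₐ[ℂ] D :=
  MonoidAlgebra.lift ℂ D (FreeGroup Bool)
    ((unitary D).subtype.comp (FreeGroup.lift fun i => if i then a else b))

theorem liftAlgHom_mono (a b : unitary D) (g : FreeGroup Bool) (c : ℂ) :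
    liftAlgHom α a b (mono α g c) =
      c • ((FreeGroup.lift (fun i => if i then a else b) g : unitary D) : D) :=
  MonoidAlgebra.lift_single _ _ _

/-- `liftAlgHom` as a `*`-homomorphism. -/
def lift (α : ℝ) (a b : unitary D) : PreTorus α →⋆ₐ[ℂ] D where
  toAlgHom := liftAlgHom α a b
  map_star' x := by
    change liftAlgHom α a b (star x) = star (liftAlgHom α a b x)
    induction x using induction with
    | zero => simp
    | add x y hx hy => rw [star_add, map_add, map_add, star_add, hx, hy]
    | mono g c => rw [star_mono, liftAlgHom_mono, liftAlgHom_mono, map_inv, star_smul]; rfl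

theorem lift_mono (a b : unitary D) (g : FreeGroup Bool) (c : ℂ) :
    lift α a b (mono α g c) =
      c • ((FreeGroup.lift (fun i => if i then a else b) g : unitary D) : D) :=
  liftAlgHom_mono a b g c

theorem lift_u (a b : unitary D) : lift α a b (u α) = a := by simp [u, lift_mono]

theorem lift_v (a b : unitary D) : lift α a b (v α) = b := by simp [v, lift_mono]

theorem norm_lift_le (a b : unitary D)
    (h : (a : D) * b = Complex.exp (2 * Real.pi * Complex.I * α) • ((b : D) * a))
    (x : PreTorus α) : ‖lift α a b x‖ ≤ ‖x‖ := by
  have hp : IsCStarSeminorm ((normSeminorm ℂ D).comp (lift α a b).toAlgHom.toLinearMap) :=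
    { mul_le := fun x y => by simpa using norm_mul_le (lift α a b x) (lift α a b y)
      star_mul_self := fun x => by
        simpa [map_star, sq] using CStarRing.norm_star_mul_self (x := lift α a b x)
      relation := by simp [lift_u, lift_v, h] }
  exact hp.le_norm x

end PreTorus

namespace NCTorus

variable {D : Type*} [CStarAlgebra D] {α : ℝ}

variable (α) in
/-- The unitary `U` of `𝔸_α`. -/
def U : unitary (NCTorus α) :=
  ⟨mk (PreTorus.u α), by
    rw [Unitary.mem_iff, star_mk, ← mk_mul, ← mk_mul]
    simp [PreTorus.u, PreTorus.star_mono, PreTorus.mono_mul_mono, ← PreTorus.one_def, mk_one]⟩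

variable (α) in
/-- The unitary `V` of `𝔸_α`. -/
def V : unitary (NCTorus α) :=
  ⟨mk (PreTorus.v α), by
    rw [Unitary.mem_iff, star_mk, ← mk_mul, ← mk_mul]
    simp [PreTorus.v, PreTorus.star_mono, PreTorus.mono_mul_mono, ← PreTorus.one_def, mk_one]⟩

/-- The defining commutation relation `U V = e^{2 π i α} V U`. -/
theorem U_mul_V : (U α : NCTorus α) * V α =
    Complex.exp (2 * Real.pi * Complex.I * α) • ((V α : NCTorus α) * U α) := by
  have h : ‖mk (PreTorus.u α * PreTorus.v α -
      Complex.exp (2 * Real.pi * Complex.I * α) • (PreTorus.v α * PreTorus.u α))‖ = 0 := by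
    rw [norm_mk, PreTorus.relation_norm]
  rw [norm_eq_zero, sub_eq_add_neg, ← neg_smul, mk_add, mk_smul, mk_mul, mk_mul, neg_smul,
    ← sub_eq_add_neg, sub_eq_zero] at h
  exact h

theorem continuous_preLift (a b : unitary D)
    (h : (a : D) * b = Complex.exp (2 * Real.pi * Complex.I * α) • ((b : D) * a)) :
    Continuous (PreTorus.lift α a b : PreTorus α →+* D) :=
  (AddMonoidHomClass.lipschitz_of_bound (PreTorus.lift α a b) 1 fun x => by
    simpa using PreTorus.norm_lift_le a b h x).continuous

/-- The universal property of `𝔸_α`: two unitaries of a unital `C^*`-algebra that satisfy the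
commutation relation define a unital `*`-homomorphism. -/
def lift (a b : unitary D)
    (h : (a : D) * b = Complex.exp (2 * Real.pi * Complex.I * α) • ((b : D) * a)) :
    NCTorus α →⋆ₐ[ℂ] D :=
  let φ : UniformSpace.Completion (PreTorus α) →+* D :=
    UniformSpace.Completion.extensionHom (PreTorus.lift α a b : PreTorus α →+* D)
      (continuous_preLift a b h)
  have hφ : ∀ x : PreTorus α, φ (mk x) = PreTorus.lift α a b x :=
    UniformSpace.Completion.extensionHom_coe _ (continuous_preLift a b h)
  have hφc : Continuous φ := UniformSpace.Completion.continuous_extension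
  { toFun := φ
    map_one' := φ.map_one
    map_mul' := φ.map_mul
    map_zero' := φ.map_zero
    map_add' := φ.map_add
    commutes' := fun r => (hφ (algebraMap ℂ (PreTorus α) r)).trans
      ((PreTorus.lift α a b).toAlgHom.commutes r)
    map_star' := fun x => by
      induction x using induction with
      | hc => exact isClosed_eq (hφc.comp continuous_star) (continuous_star.comp hφc)
      | h x => rw [star_mk, hφ, hφ, map_star] }

theorem lift_mk (a b : unitary D)
    (h : (a : D) * b = Complex.exp (2 * Real.pi * Complex.I * α) • ((b : D) * a))
    (x : PreTorus α) : lift a b h (mk x) = PreTorus.lift α a b x :=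
  UniformSpace.Completion.extensionHom_coe _ (continuous_preLift a b h) x

theorem lift_U (a b : unitary D)
    (h : (a : D) * b = Complex.exp (2 * Real.pi * Complex.I * α) • ((b : D) * a)) :
    lift a b h (U α) = a := (lift_mk a b h _).trans (PreTorus.lift_u a b)

theorem lift_V (a b : unitary D)
    (h : (a : D) * b = Complex.exp (2 * Real.pi * Complex.I * α) • ((b : D) * a)) :
    lift a b h (V α) = b := (lift_mk a b h _).trans (PreTorus.lift_v a b)

/-- The uniqueness part of the universal property. -/
theorem hom_ext {φ ψ : NCTorus α →⋆ₐ[ℂ] D} (hU : φ (U α) = ψ (U α)) (hV : φ (V α) = ψ (V α)) :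
    φ = ψ := by
  have key : ∀ g : FreeGroup Bool, φ (mk (PreTorus.mono α g 1)) = ψ (mk (PreTorus.mono α g 1)) := by
    have hmul : ∀ g h : FreeGroup Bool, mk (PreTorus.mono α (g * h) 1) =
        mk (PreTorus.mono α g 1) * mk (PreTorus.mono α h 1) := fun g h => by
      rw [← mk_mul, PreTorus.mono_mul_mono, mul_one]
    have hinv : ∀ g : FreeGroup Bool, mk (PreTorus.mono α g⁻¹ 1) =
        star (mk (PreTorus.mono α g 1)) := fun g => by
      rw [star_mk, PreTorus.star_mono, star_one]
    intro g
    induction g using FreeGroup.induction_on with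
    | C1 => rw [← PreTorus.one_def, mk_one, map_one, map_one]
    | of i => cases i; exacts [hV, hU]
    | inv_of i hi => rw [hinv, map_star, map_star, hi]
    | mul g h hg hh => rw [hmul, map_mul, map_mul, hg, hh]
  have hφ : Continuous φ := (AddMonoidHomClass.lipschitz_of_bound φ 1 fun x => by
    simpa using NonUnitalStarAlgHom.norm_apply_le φ x).continuous
  have hψ : Continuous ψ := (AddMonoidHomClass.lipschitz_of_bound ψ 1 fun x => by
    simpa using NonUnitalStarAlgHom.norm_apply_le ψ x).continuous
  ext x
  induction x using induction with
  | hc => exact isClosed_eq hφ hψ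
  | h x =>
    induction x using PreTorus.induction with
    | zero =>
      have : mk (0 : PreTorus α) = 0 := by rw [← zero_smul ℂ (0 : PreTorus α), mk_smul, zero_smul]
      rw [this, map_zero, map_zero]
    | add x y hx hy => rw [mk_add, map_add, map_add, hx, hy]
    | mono g c =>
      have : PreTorus.mono α g c = c • PreTorus.mono α g 1 := by rw [PreTorus.smul_mono, mul_one]
      rw [this, mk_smul, map_smul, map_smul, key]

end NCTorus

/-! ### The canonical trace -/

section Regular

/-- The Hilbert space `ℓ²(ℤ × ℤ)`. -/
abbrev EllTwo : Type := lp (fun _ : ℤ × ℤ => ℂ) 2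

/-- The unitary operator `(W x) i = c i * x (e i)` on `ℓ²(ℤ × ℤ)`, for a bijection `e` of `ℤ × ℤ` and
phases `c`. -/
def weightedShift (c : ℤ × ℤ → Circle) (e : ℤ × ℤ ≃ ℤ × ℤ) : EllTwo →ₗᵢ[ℂ] EllTwo where
  toFun x := ⟨fun i => (c i : ℂ) * x (e i), by
    change Memℓp (fun i => (c i : ℂ) * x (e i)) 2
    have hx := lp.memℓp x
    rw [memℓp_gen_iff (by norm_num)] at hx ⊢
    simp only [norm_mul, Circle.norm_coe, one_mul]
    exact (e.summable_iff (f := fun i => ‖x i‖ ^ (2 : ENNReal).toReal)).2 hx⟩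
  map_add' x y := by ext i; exact mul_add _ _ _
  map_smul' a x := by ext i; exact mul_left_comm _ _ _
  norm_map' x := by
    rw [lp.norm_eq_tsum_rpow (by norm_num), lp.norm_eq_tsum_rpow (by norm_num)]
    congr 1
    change ∑' i, ‖(c i : ℂ) * x (e i)‖ ^ (2 : ENNReal).toReal = _
    simp only [norm_mul, Circle.norm_coe, one_mul]
    exact e.tsum_eq (fun i => ‖x i‖ ^ (2 : ENNReal).toReal)

theorem weightedShift_apply (c : ℤ × ℤ → Circle) (e : ℤ × ℤ ≃ ℤ × ℤ) (x : EllTwo) (i : ℤ × ℤ) :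
    weightedShift c e x i = (c i : ℂ) * x (e i) := rfl

/-- `weightedShift` as a unitary element of `B(ℓ²(ℤ × ℤ))`. -/
def weightedShiftUnitary (c : ℤ × ℤ → Circle) (e : ℤ × ℤ ≃ ℤ × ℤ) :
    unitary (EllTwo →L[ℂ] EllTwo) :=
  Unitary.linearIsometryEquiv.symm
    (LinearIsometryEquiv.ofSurjective (weightedShift c e) fun x =>
      ⟨weightedShift (fun i => (c (e.symm i))⁻¹) e.symm x, by
        ext i
        simp [weightedShift_apply]⟩)

theorem weightedShiftUnitary_apply (c : ℤ × ℤ → Circle) (e : ℤ × ℤ ≃ ℤ × ℤ) (x : EllTwo)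
    (i : ℤ × ℤ) :
    (weightedShiftUnitary c e : EllTwo →L[ℂ] EllTwo) x i = (c i : ℂ) * x (e i) := rfl

/-- The operator `(U x) (m, n) = x (m - 1, n)`, that is `δ_{m, n} ↦ δ_{m + 1, n}`. -/
def regularU : unitary (EllTwo →L[ℂ] EllTwo) :=
  weightedShiftUnitary (fun _ => 1) ((Equiv.subRight 1).prodCongr (Equiv.refl ℤ))

/-- The operator `(V x) (m, n) = e^{- 2 π i α m} x (m, n - 1)`, that is
`δ_{m, n} ↦ e^{- 2 π i α m} δ_{m, n + 1}`. -/
def regularV (α : ℝ) : unitary (EllTwo →L[ℂ] EllTwo) :=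
  weightedShiftUnitary (fun i => Circle.exp (-(2 * Real.pi * α * i.1)))
    ((Equiv.refl ℤ).prodCongr (Equiv.subRight 1))

theorem regularU_apply (x : EllTwo) (m n : ℤ) :
    (regularU : EllTwo →L[ℂ] EllTwo) x (m, n) = x (m - 1, n) := by
  simp [regularU, weightedShiftUnitary_apply]

theorem regularV_apply (α : ℝ) (x : EllTwo) (m n : ℤ) :
    (regularV α : EllTwo →L[ℂ] EllTwo) x (m, n) =
      Circle.exp (-(2 * Real.pi * α * m)) * x (m, n - 1) := by
  simp [regularV, weightedShiftUnitary_apply]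

theorem regularU_zpow_apply (k : ℤ) (x : EllTwo) (m n : ℤ) :
    ((regularU ^ k : unitary (EllTwo →L[ℂ] EllTwo)) : EllTwo →L[ℂ] EllTwo) x (m, n) =
      x (m - k, n) := by
  induction k using Int.induction_on generalizing x m n with
  | zero => simp
  | succ k ih =>
    rw [zpow_add_one, Submonoid.coe_mul, mul_apply_eq_comp, ih, regularU_apply, sub_sub]
  | pred k ih =>
    rw [zpow_sub_one, Submonoid.coe_mul, mul_apply_eq_comp, ih]
    obtain ⟨y, rfl⟩ : ∃ y, (regularU : EllTwo →L[ℂ] EllTwo) y = x :=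
      ⟨((regularU⁻¹ : unitary (EllTwo →L[ℂ] EllTwo)) : EllTwo →L[ℂ] EllTwo) x, by
        rw [← mul_apply_eq_comp, ← Submonoid.coe_mul, mul_inv_cancel]; rfl⟩
    rw [← mul_apply_eq_comp, ← Submonoid.coe_mul, inv_mul_cancel, regularU_apply,
      show m - (-(k : ℤ) - 1) - 1 = m - -(k : ℤ) by ring]
    rfl

theorem regularV_zpow_apply (α : ℝ) (k : ℤ) (x : EllTwo) (m n : ℤ) :
    ((regularV α ^ k : unitary (EllTwo →L[ℂ] EllTwo)) : EllTwo →L[ℂ] EllTwo) x (m, n) =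
      (Circle.exp (-(2 * Real.pi * α * m)) ^ k : Circle) * x (m, n - k) := by
  induction k using Int.induction_on generalizing x m n with
  | zero => simp
  | succ k ih =>
    rw [zpow_add_one, Submonoid.coe_mul, mul_apply_eq_comp, ih, regularV_apply, zpow_add_one,
      sub_sub, Circle.coe_mul]
    exact (mul_assoc _ _ _).symm
  | pred k ih =>
    rw [zpow_sub_one, Submonoid.coe_mul, mul_apply_eq_comp, ih]
    obtain ⟨y, rfl⟩ : ∃ y, (regularV α : EllTwo →L[ℂ] EllTwo) y = x :=
      ⟨(((regularV α)⁻¹ : unitary (EllTwo →L[ℂ] EllTwo)) : EllTwo →L[ℂ] EllTwo) x, by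
        rw [← mul_apply_eq_comp, ← Submonoid.coe_mul, mul_inv_cancel]; rfl⟩
    rw [← mul_apply_eq_comp, ← Submonoid.coe_mul, inv_mul_cancel, regularV_apply, zpow_sub_one,
      show n - (-(k : ℤ) - 1) - 1 = n - -(k : ℤ) by ring]
    generalize Circle.exp (-(2 * Real.pi * α * m)) = c
    change _ * y (m, n - -(k : ℤ)) = _
    rw [Circle.coe_mul, Circle.coe_inv]
    field_simp [Circle.coe_ne_zero c]

theorem regular_relation (α : ℝ) :
    (regularU : EllTwo →L[ℂ] EllTwo) * regularV α =
      Complex.exp (2 * Real.pi * Complex.I * α) •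
        ((regularV α : EllTwo →L[ℂ] EllTwo) * regularU) := by
  ext x ⟨m, n⟩
  simp only [mul_apply_eq_comp, smul_apply, lp.coeFn_smul,
    Pi.smul_apply, regularU_apply, regularV_apply, smul_eq_mul, Circle.coe_exp, ← mul_assoc,
    ← Complex.exp_add]
  congr 2
  push_cast
  ring

end Regular

namespace NCTorus

/-- The representation of `𝔸_α` on `ℓ²(ℤ × ℤ)` (the GNS representation of the canonical trace, with
`δ_{m, n}` in the role of `U^m V^n ξ`). -/
def regularRep (α : ℝ) : NCTorus α →⋆ₐ[ℂ] (EllTwo →L[ℂ] EllTwo) :=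
  lift regularU (regularV α) (regular_relation α)

/-- The canonical trace `τ (a) = ⟨δ_{0, 0}, π (a) δ_{0, 0}⟩`. -/
def trace (α : ℝ) : NCTorus α →L[ℂ] ℂ :=
  LinearMap.mkContinuous
    { toFun := fun a => inner ℂ (lp.single 2 (0, 0) 1 : EllTwo)
        (regularRep α a (lp.single 2 (0, 0) 1))
      map_add' := fun a b => by simp
      map_smul' := fun c a => by simp } 1 fun a => by
    have h1 : ‖(lp.single 2 (0, 0) 1 : EllTwo)‖ = 1 := by simp
    have h2 : ‖regularRep α a‖ ≤ ‖a‖ := NonUnitalStarAlgHom.norm_apply_le _ a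
    calc _ ≤ ‖(lp.single 2 (0, 0) 1 : EllTwo)‖ * ‖regularRep α a (lp.single 2 (0, 0) 1)‖ :=
          norm_inner_le_norm _ _
      _ ≤ 1 * (‖a‖ * 1) := by
          rw [h1]
          gcongr
          refine ((regularRep α a).le_opNorm _).trans ?_
          rw [h1]
          gcongr
      _ = 1 * ‖a‖ := by ring

theorem trace_apply (α : ℝ) (a : NCTorus α) :
    trace α a = regularRep α a (lp.single 2 (0, 0) 1) (0, 0) := by
  refine (lp.inner_single_left (𝕜 := ℂ) _ _ _).trans ?_
  simp

/-- The formula `τ (U^m V^n) = δ_{m, 0} δ_{n, 0}`. -/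
theorem trace_U_zpow_mul_V_zpow (α : ℝ) (m n : ℤ) :
    trace α (((U α ^ m : unitary (NCTorus α)) : NCTorus α) *
      ((V α ^ n : unitary (NCTorus α)) : NCTorus α)) = if m = 0 ∧ n = 0 then 1 else 0 := by
  have key : ∀ (a : unitary (NCTorus α)) (b : unitary (EllTwo →L[ℂ] EllTwo)) (k : ℤ),
      regularRep α a = b → regularRep α ((a ^ k : unitary (NCTorus α)) : NCTorus α) =
        ((b ^ k : unitary (EllTwo →L[ℂ] EllTwo)) : EllTwo →L[ℂ] EllTwo) := by
    intro a b k h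
    have h' : Unitary.map
        ({ toFun := regularRep α
           map_one' := map_one _
           map_mul' := map_mul _
           map_star' := map_star _ } : NCTorus α →⋆* (EllTwo →L[ℂ] EllTwo)) a = b := Subtype.ext h
    rw [← h', ← map_zpow]
    rfl
  rw [trace_apply, map_mul, key _ _ m (lift_U _ _ _), key _ _ n (lift_V _ _ _),
    mul_apply_eq_comp, regularU_zpow_apply, regularV_zpow_apply]
  by_cases hm : m = 0 <;> by_cases hn : n = 0 <;> simp [hm, hn, lp.single_apply]

end NCTorus

/-! ### The Anzai skew-product -/

section CircleCalculus

variable {A : Type*} [CStarAlgebra A]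

theorem continuous_circle_coe : Continuous fun z : Circle => (z : ℂ) := continuous_subtype_val

/-- The inclusion of the spectrum of a unitary into the unit circle. -/
def spectrumToCircle (u : unitary A) : C(spectrum ℂ (u : A), Circle) where
  toFun z := ⟨z, spectrum.subset_circle_of_unitary u.2 z.2⟩
  continuous_toFun := continuous_subtype_val.subtype_mk _

/-- The continuous functional calculus `C(𝕋) → A`, `g ↦ g (u)`, of a unitary `u`. -/
def circleCalculus (u : unitary A) : C(Circle, ℂ) →⋆ₐ[ℂ] A :=
  (cfcHom (R := ℂ) (p := IsStarNormal) (a := (u : A)) inferInstance).comp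
    (ContinuousMap.compStarAlgHom' ℂ ℂ (spectrumToCircle u))

/-- The functional calculus sends the coordinate function to `u`. -/
theorem circleCalculus_coe (u : unitary A) :
    circleCalculus u ⟨fun z => (z : ℂ), continuous_circle_coe⟩ = u :=
  cfcHom_id (R := ℂ) (p := IsStarNormal) (a := (u : A)) inferInstance

/-- The unitary `f (u)` for continuous `f : 𝕋 → 𝕋`. -/
def circleApply (f : C(Circle, Circle)) (u : unitary A) : unitary A :=
  ⟨circleCalculus u ⟨fun z => (f z : ℂ), continuous_circle_coe.comp f.continuous⟩, by
    rw [Unitary.mem_iff, ← map_star, ← map_mul, ← map_mul]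
    constructor
    · convert map_one (circleCalculus u)
      ext z
      simp [← Circle.coe_inv_eq_conj]
    · convert map_one (circleCalculus u)
      ext z
      simp [← Circle.coe_inv_eq_conj]⟩

/-- The unitary `c u` for `c ∈ 𝕋`. -/
def rotateUnitary (c : Circle) (u : unitary A) : unitary A :=
  ⟨(c : ℂ) • (u : A), by
    rw [Unitary.mem_iff, star_smul, smul_mul_smul_comm, smul_mul_smul_comm]
    simp [← Circle.coe_inv_eq_conj]⟩

theorem commute_circleApply (f : C(Circle, Circle)) (u : unitary A) :
    Commute (u : A) (circleApply f u) := by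
  conv_lhs => rw [← circleCalculus_coe u]
  change _ * circleCalculus u _ = circleCalculus u _ * _
  rw [← map_mul, ← map_mul, mul_comm]

end CircleCalculus

namespace NCTorus

theorem anzai_relation (α θ : ℝ) (f : C(Circle, Circle)) :
    ((rotateUnitary (Circle.exp θ) (U α) : unitary (NCTorus α)) : NCTorus α) *
        (circleApply f (U α) * V α : unitary (NCTorus α)) =
      Complex.exp (2 * Real.pi * Complex.I * α) •
        (((circleApply f (U α) * V α : unitary (NCTorus α)) : NCTorus α) *
          (rotateUnitary (Circle.exp θ) (U α) : unitary (NCTorus α))) := by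
  have h : ((U α : NCTorus α) * circleApply f (U α)) = circleApply f (U α) * (U α : NCTorus α) :=
    commute_circleApply f (U α)
  change ((Circle.exp θ : ℂ) • (U α : NCTorus α)) * ((circleApply f (U α) : NCTorus α) * V α) =
    _ • (((circleApply f (U α) : NCTorus α) * V α) * ((Circle.exp θ : ℂ) • (U α : NCTorus α)))
  rw [smul_mul_assoc, ← mul_assoc, h, mul_assoc, U_mul_V, mul_smul_comm, mul_smul_comm, smul_comm]
  simp only [mul_assoc]

/-- The Anzai skew-product `Φ_{θ, f}`: the unital `*`-homomorphism `𝔸_α → 𝔸_α` with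
`U ↦ e^{i θ} U` and `V ↦ f (U) V` (which is an automorphism, as `f (U)` is unitary). -/
def anzai (α θ : ℝ) (f : C(Circle, Circle)) : NCTorus α →⋆ₐ[ℂ] NCTorus α :=
  lift (rotateUnitary (Circle.exp θ) (U α)) (circleApply f (U α) * V α) (anzai_relation α θ f)

theorem anzai_U (α θ : ℝ) (f : C(Circle, Circle)) :
    anzai α θ f (U α) = (Circle.exp θ : ℂ) • (U α : NCTorus α) := lift_U _ _ _

theorem anzai_V (α θ : ℝ) (f : C(Circle, Circle)) :
    anzai α θ f (V α) = (circleApply f (U α) : NCTorus α) * V α := lift_V _ _ _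

end NCTorus

/-! ### Invariant states, ergodicity and the cohomological equations -/

section States

variable {A : Type*} [CStarAlgebra A]

/-- The states of a unital `C^*`-algebra: positive functionals with `φ 1 = 1`. -/
def states (A : Type*) [CStarAlgebra A] : Set (A →L[ℂ] ℂ) :=
  {φ | φ 1 = 1 ∧ ∀ a, 0 ≤ φ (star a * a)}

/-- The states that are invariant under `Φ`. -/
def invariantStates (Φ : A →⋆ₐ[ℂ] A) : Set (A →L[ℂ] ℂ) :=
  {φ | φ ∈ states A ∧ ∀ a, φ (Φ a) = φ a}

/-- An ergodic state for `Φ` is an extreme point of the convex set of invariant states. -/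
def IsErgodicState (Φ : A →⋆ₐ[ℂ] A) (φ : A →L[ℂ] ℂ) : Prop :=
  φ ∈ Set.extremePoints ℝ (invariantStates Φ)

/-- `(A, Φ)` is uniquely ergodic if there is exactly one invariant state. -/
def IsUniquelyErgodic (Φ : A →⋆ₐ[ℂ] A) : Prop := ∃! φ, φ ∈ invariantStates Φ

end States

namespace Circle

instance : MeasurableSpace Circle := borel Circle
instance : BorelSpace Circle := ⟨rfl⟩

/-- The normalised Lebesgue measure `dz / (2 π i z)` on the circle: the image of the normalised Haar
measure of `ℝ / ℤ` under `x ↦ e^{2 π i x}`. -/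
def lebesgue : MeasureTheory.Measure Circle :=
  (AddCircle.haarAddCircle (T := 1)).map AddCircle.toCircle

instance : MeasureTheory.IsProbabilityMeasure lebesgue :=
  MeasureTheory.Measure.isProbabilityMeasure_map
    (AddCircle.continuous_toCircle (T := 1)).measurable.aemeasurable

/-- The rotation `R_a z = e^{2 π i a} z`. -/
def rot (a : ℝ) (z : Circle) : Circle := Circle.exp (2 * Real.pi * a) * z

end Circle

/-- The functions `f_n`, with `f_n (U) V^n = (f (U) V)^n`. -/
def cocycle (α : ℝ) (f : C(Circle, Circle)) : ℤ → Circle → ℂ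
  | Int.ofNat n => fun z => ∏ l ∈ Finset.range n, (f (Circle.rot (-(l * α)) z) : ℂ)
  | Int.negSucc k => fun z =>
      ∏ l ∈ Finset.Icc 1 (k + 1), starRingEnd ℂ (f (Circle.rot (l * α) z) : ℂ)

/-- The cohomological equation `(g ∘ R_{θ / 2 π}) f_n = g` in `L²(𝕋)`. -/
def SolvesCohomological (α θ : ℝ) (f : C(Circle, Circle)) (n : ℤ)
    (g : MeasureTheory.Lp ℂ 2 Circle.lebesgue) : Prop :=
  (fun z => g (Circle.rot (θ / (2 * Real.pi)) z) * cocycle α f n z) =ᵐ[Circle.lebesgue] g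

end


/-!
On the elements `h (U) V^n`, whose linear span is dense in `𝔸_α`, the skew-product acts by
`Φ (h (U) V^n) = ((h ∘ R_{θ / 2 π}) f_n) (U) V^n`, so that an isometry `W` of `L²(𝕋)`, with
`W g = (g ∘ R_{θ / 2 π}) f_n`, governs the `n`-th Fourier mode. Irrational rotations being uniquely
ergodic, an invariant state restricts to Lebesgue measure on the functions of `U`; by Cauchy–Schwarz
it is then given on the `n`-th mode by a vector `g` of `L²(𝕋)`, and invariance makes `g` a fixed
vector of `W`. If no nonzero solution exists for `n ≠ 0`, the state is therefore the trace.
Conversely, a solution `g` gives a vector `x` in the `n`-th summand of the GNS space of the trace,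
with cyclic vector `ξ`. The vector state of `x` is a multiple of the trace and `⟨x, π (·) ξ⟩` is
invariant, so the vector functionals of `ξ ± c x` for `c = 1, i`, suitably normalised, are invariant
states with midpoint the trace; ergodicity forces `⟨x, π (·) ξ⟩ = 0` and thus `g = 0`.
-/

noncomputable section

open MeasureTheory
open scoped CStarAlgebra ComplexConjugate ComplexOrder InnerProductSpace

section StarHom

variable {A B : Type*} [CStarAlgebra A] [CStarAlgebra B]

theorem starAlgHom_unitary_zpow (φ : A →⋆ₐ[ℂ] B) {a : unitary A} {b : unitary B} (h : φ a = b)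
    (k : ℤ) : φ ((a ^ k : unitary A) : A) = ((b ^ k : unitary B) : B) := by
  have hb : Unitary.map ⟨(φ : A →* B), map_star φ⟩ a = b := Subtype.ext h
  rw [← hb, ← map_zpow]
  rfl

/-- A `*`-homomorphism of `C^*`-algebras as a continuous linear map. -/
def starAlgHomCLM (φ : A →⋆ₐ[ℂ] B) : A →L[ℂ] B := ⟨φ.toAlgHom.toLinearMap, map_continuous φ⟩

theorem coe_rotateUnitary (c : Circle) (u : unitary A) :
    (rotateUnitary c u : A) = (c : ℂ) • (u : A) := rfl

theorem rotateUnitary_zpow (c : Circle) (u : unitary A) (k : ℤ) :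
    rotateUnitary c u ^ k = rotateUnitary (c ^ k) (u ^ k) := by
  let scale : Circle × unitary A →* unitary A :=
    { toFun := fun p => rotateUnitary p.1 p.2
      map_one' := Subtype.ext (one_smul ℂ (1 : A))
      map_mul' := fun p q => Subtype.ext
        (smul_mul_smul_comm (p.1 : ℂ) (p.2 : A) (q.1 : ℂ) (q.2 : A)).symm }
  exact (map_zpow scale (c, u) k).symm

end StarHom

section CircleFunctions

/-- A continuous function `𝕋 → 𝕋`, regarded as a unitary element of `C(𝕋)`. -/
def circleUnitary : C(Circle, Circle) →* unitary C(Circle, ℂ) where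
  toFun f := ⟨⟨fun z => f z, continuous_circle_coe.comp f.continuous⟩, by
    constructor <;> ext z <;> simp [← Circle.coe_inv_eq_conj]⟩
  map_one' := rfl
  map_mul' _ _ := rfl

theorem circleUnitary_apply (f : C(Circle, Circle)) (z : Circle) :
    (circleUnitary f : C(Circle, ℂ)) z = f z := rfl

/-- The coordinate function `z ↦ z` of the circle; its powers are the characters of `𝕋`. -/
def circleCoord : unitary C(Circle, ℂ) := circleUnitary (ContinuousMap.id Circle)

theorem circleCoord_zpow_apply (k : ℤ) (z : Circle) :
    ((circleCoord ^ k : unitary C(Circle, ℂ)) : C(Circle, ℂ)) z = ((z ^ k : Circle) : ℂ) := by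
  rw [circleCoord, ← map_zpow]
  rfl

/-- The rotation `R_a` of the circle, as a continuous map. -/
def circleRotation (a : ℝ) : C(Circle, Circle) := ⟨Circle.rot a, by unfold Circle.rot; fun_prop⟩

theorem circleRotation_apply (a : ℝ) (z : Circle) : circleRotation a z = Circle.rot a z := rfl

theorem circleCoord_zpow_comp_circleRotation (k : ℤ) (a : ℝ) :
    ((circleCoord ^ k : unitary C(Circle, ℂ)) : C(Circle, ℂ)).comp (circleRotation a) =
      ((Circle.exp (2 * Real.pi * a) ^ k : Circle) : ℂ) •
        ((circleCoord ^ k : unitary C(Circle, ℂ)) : C(Circle, ℂ)) := by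
  ext z
  simp [circleCoord_zpow_apply, circleRotation_apply, Circle.rot, mul_zpow]

theorem span_circleCoord_zpow_dense :
    Dense (Submodule.span ℂ (Set.range fun k : ℤ =>
      ((circleCoord ^ k : unitary C(Circle, ℂ)) : C(Circle, ℂ))) : Set C(Circle, ℂ)) := by
  let e : AddCircle (1 : ℝ) ≃ₜ Circle := AddCircle.homeomorphCircle one_ne_zero
  let E : C(AddCircle (1 : ℝ), ℂ) ≃⋆ₐ[ℂ] C(Circle, ℂ) := e.symm.compStarAlgEquiv' ℂ ℂ
  let T : C(AddCircle (1 : ℝ), ℂ) →L[ℂ] C(Circle, ℂ) := starAlgHomCLM E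
  have hfourier : ∀ k : ℤ, T (fourier k) = (circleCoord ^ k : unitary C(Circle, ℂ)) := by
    intro k
    ext z
    obtain ⟨x, rfl⟩ := e.surjective z
    change fourier k (e.symm (e x)) = _
    rw [e.symm_apply_apply, circleCoord_zpow_apply, fourier_apply, AddCircle.toCircle_zsmul,
      AddCircle.homeomorphCircle_apply]
  have hrange : (Set.range fun k : ℤ => ((circleCoord ^ k : unitary C(Circle, ℂ)) : C(Circle, ℂ))) =
      T '' Set.range (@fourier 1) := by
    rw [← Set.range_comp]
    exact congrArg Set.range (funext fun k => (hfourier k).symm)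
  rw [Submodule.dense_iff_topologicalClosure_eq_top, hrange]
  have hT : DenseRange T := (EquivLike.surjective E).denseRange
  simpa only [Submodule.map_span, ContinuousLinearMap.coe_coe] using
    hT.topologicalClosure_map_submodule (span_fourier_closure_eq_top (T := 1))

theorem continuousLinearMap_circle_ext {E : Type*} [NormedAddCommGroup E] [NormedSpace ℂ E]
    {F G : C(Circle, ℂ) →L[ℂ] E}
    (h : ∀ k : ℤ, F (circleCoord ^ k : unitary C(Circle, ℂ)) =
      G (circleCoord ^ k : unitary C(Circle, ℂ))) : F = G :=
  ContinuousLinearMap.ext_on span_circleCoord_zpow_dense (Set.forall_mem_range.2 h)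

theorem starAlgHom_circle_ext {A : Type*} [CStarAlgebra A] {φ ψ : C(Circle, ℂ) →⋆ₐ[ℂ] A}
    (h : φ circleCoord = ψ circleCoord) : φ = ψ := by
  have hCLM : starAlgHomCLM φ = starAlgHomCLM ψ := by
    refine continuousLinearMap_circle_ext fun k => ?_
    let b : unitary A := ⟨φ circleCoord, by
      simp [Unitary.mem_iff, ← map_star, ← map_mul]⟩
    exact (starAlgHom_unitary_zpow φ (b := b) rfl k).trans
      (starAlgHom_unitary_zpow ψ (b := b) h.symm k).symm
  exact DFunLike.ext _ _ fun x => DFunLike.congr_fun hCLM x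

theorem measurePreserving_circleRotation (a : ℝ) :
    MeasurePreserving (circleRotation a) Circle.lebesgue Circle.lebesgue := by
  have htoCircle : Measurable (AddCircle.toCircle (T := 1)) :=
    AddCircle.continuous_toCircle.measurable
  have hsemiconj : circleRotation a ∘ AddCircle.toCircle (T := 1) =
      AddCircle.toCircle ∘ ((a : AddCircle (1 : ℝ)) + ·) := by
    funext x
    simp [circleRotation_apply, Circle.rot, AddCircle.toCircle_add, AddCircle.toCircle_apply_mk]
  refine ⟨(circleRotation a).continuous.measurable, ?_⟩
  rw [Circle.lebesgue, Measure.map_map (circleRotation a).continuous.measurable htoCircle,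
    hsemiconj, ← Measure.map_map htoCircle (measurable_const_add _), map_add_left_eq_self]

/-- The mean `h ↦ ∫ h dm` on `C(𝕋)`, encoded as the inner product with `1` in `L²(𝕋)`. -/
def circleMean : C(Circle, ℂ) →L[ℂ] ℂ :=
  innerSL ℂ (ContinuousMap.toLp 2 Circle.lebesgue ℂ 1) ∘L ContinuousMap.toLp 2 Circle.lebesgue ℂ

theorem circleMean_apply (h : C(Circle, ℂ)) : circleMean h = ∫ z, h z ∂Circle.lebesgue := by
  simp [circleMean, ContinuousMap.inner_toLp]

theorem circleMean_one : circleMean 1 = 1 := by simp [circleMean_apply]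

theorem circleMean_comp_circleRotation (a : ℝ) (h : C(Circle, ℂ)) :
    circleMean (h.comp (circleRotation a)) = circleMean h := by
  have hmap := (measurePreserving_circleRotation a).map_eq
  rw [circleMean_apply, circleMean_apply]
  conv_rhs => rw [← hmap, integral_map (circleRotation a).continuous.aemeasurable
    h.continuous.aestronglyMeasurable]
  rfl

theorem exp_zpow_ne_one_of_irrational {a : ℝ} (ha : Irrational a) {k : ℤ} (hk : k ≠ 0) :
    Circle.exp (2 * Real.pi * a) ^ k ≠ 1 := by
  rw [← Circle.exp_zsmul, Ne, Circle.exp_eq_one]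
  rintro ⟨n, hn⟩
  refine (ha.intCast_mul hk).ne_int n (mul_right_cancel₀ Real.two_pi_pos.ne' ?_)
  rw [← hn, zsmul_eq_mul]
  ring

theorem map_circleCoord_zpow_eq_zero {a : ℝ} (ha : Irrational a) {F : C(Circle, ℂ) →L[ℂ] ℂ}
    (hF : ∀ h, F (h.comp (circleRotation a)) = F h) {k : ℤ} (hk : k ≠ 0) :
    F (circleCoord ^ k : unitary C(Circle, ℂ)) = 0 := by
  have h := hF (circleCoord ^ k : unitary C(Circle, ℂ))
  rw [circleCoord_zpow_comp_circleRotation, map_smul, smul_eq_mul] at h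
  by_contra h0
  exact exp_zpow_ne_one_of_irrational ha hk (Circle.coe_eq_one.1 ((mul_eq_right₀ h0).1 h))

theorem circleMean_circleCoord_zpow (k : ℤ) :
    circleMean (circleCoord ^ k : unitary C(Circle, ℂ)) = if k = 0 then 1 else 0 := by
  split_ifs with hk
  · simp [hk, circleMean_one]
  · exact map_circleCoord_zpow_eq_zero irrational_sqrt_two (circleMean_comp_circleRotation _) hk

theorem eq_smul_circleMean_of_rotation_invariant {a : ℝ} (ha : Irrational a)
    {F : C(Circle, ℂ) →L[ℂ] ℂ} (hF : ∀ h, F (h.comp (circleRotation a)) = F h) :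
    F = F 1 • circleMean := by
  refine continuousLinearMap_circle_ext fun k => ?_
  rw [smul_apply, circleMean_circleCoord_zpow]
  split_ifs with hk
  · simp [hk]
  · rw [map_circleCoord_zpow_eq_zero ha hF hk, smul_zero]

end CircleFunctions

section Calculus

variable {A B : Type*} [CStarAlgebra A] [CStarAlgebra B]

theorem circleCalculus_circleCoord (u : unitary A) : circleCalculus u circleCoord = u :=
  circleCalculus_coe u

theorem circleCalculus_circleCoord_zpow (u : unitary A) (k : ℤ) :
    circleCalculus u (circleCoord ^ k : unitary C(Circle, ℂ)) = (u ^ k : unitary A) :=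
  starAlgHom_unitary_zpow _ (circleCalculus_circleCoord u) k

theorem map_circleCalculus (φ : A →⋆ₐ[ℂ] B) {u : unitary A} {w : unitary B} (h : φ u = w)
    (p : C(Circle, ℂ)) : φ (circleCalculus u p) = circleCalculus w p := by
  have hcomp : φ.comp (circleCalculus u) = circleCalculus w := starAlgHom_circle_ext (by
    rw [StarAlgHom.comp_apply, circleCalculus_circleCoord, h, circleCalculus_circleCoord])
  exact DFunLike.congr_fun hcomp p

theorem circleCalculus_rotateUnitary (a : ℝ) (u : unitary A) (p : C(Circle, ℂ)) :
    circleCalculus (rotateUnitary (Circle.exp (2 * Real.pi * a)) u) p =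
      circleCalculus u (p.comp (circleRotation a)) := by
  have hcomp : circleCalculus (rotateUnitary (Circle.exp (2 * Real.pi * a)) u) =
      (circleCalculus u).comp (ContinuousMap.compStarAlgHom' ℂ ℂ (circleRotation a)) := by
    refine starAlgHom_circle_ext ?_
    have hcoord := circleCoord_zpow_comp_circleRotation 1 a
    rw [zpow_one, zpow_one] at hcoord
    rw [circleCalculus_circleCoord, StarAlgHom.comp_apply, ContinuousMap.compStarAlgHom'_apply,
      hcoord, map_smul, circleCalculus_circleCoord, coe_rotateUnitary]
  exact DFunLike.congr_fun hcomp p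

theorem unitary_mul_circleCalculus {u v : unitary A} {a : ℝ}
    (h : v * u = rotateUnitary (Circle.exp (2 * Real.pi * a)) u * v) (p : C(Circle, ℂ)) :
    (v : A) * circleCalculus u p = circleCalculus u (p.comp (circleRotation a)) * (v : A) := by
  have hconj : Unitary.conjStarAlgAut ℂ A v u =
      rotateUnitary (Circle.exp (2 * Real.pi * a)) u := by
    rw [Unitary.conjStarAlgAut_apply, ← Unitary.coe_star, ← Submonoid.coe_mul, ← Submonoid.coe_mul,
      h, mul_assoc, Unitary.mul_star_self, mul_one]
  have hmap := map_circleCalculus (Unitary.conjStarAlgAut ℂ A v : A →⋆ₐ[ℂ] A) hconj p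
  rw [circleCalculus_rotateUnitary] at hmap
  rw [← hmap]
  change _ = Unitary.conjStarAlgAut ℂ A v _ * _
  rw [Unitary.conjStarAlgAut_apply, mul_assoc, Unitary.coe_star_mul_self, mul_one]

end Calculus

namespace NCTorus

variable {α : ℝ}

theorem U_mul_V_zpow (l : ℤ) :
    U α * V α ^ l = rotateUnitary (Circle.exp (2 * Real.pi * α) ^ l) (V α ^ l) * U α := by
  have hconj : U α * V α * (U α)⁻¹ = rotateUnitary (Circle.exp (2 * Real.pi * α)) (V α) := by
    rw [mul_inv_eq_iff_eq_mul]
    ext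
    rw [Submonoid.coe_mul, Submonoid.coe_mul, coe_rotateUnitary, U_mul_V, smul_mul_assoc,
      Circle.coe_exp]
    congr 2
    push_cast
    ring
  rw [← mul_inv_eq_iff_eq_mul, ← conj_zpow, hconj, rotateUnitary_zpow]

theorem V_zpow_mul_U (l : ℤ) :
    V α ^ l * U α = rotateUnitary (Circle.exp (2 * Real.pi * -(l * α))) (U α) * V α ^ l := by
  ext
  have hexp : Circle.exp (2 * Real.pi * -(l * α)) * Circle.exp (2 * Real.pi * α) ^ l = 1 := by
    rw [← Circle.exp_zsmul, ← Circle.exp_add, zsmul_eq_mul, Circle.exp_eq_one]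
    exact ⟨0, by push_cast; ring⟩
  have hUV := congrArg (Subtype.val (p := (· ∈ unitary (NCTorus α)))) (U_mul_V_zpow (α := α) l)
  simp only [Submonoid.coe_mul, coe_rotateUnitary, smul_mul_assoc] at hUV ⊢
  rw [hUV, smul_smul, ← Circle.coe_mul, hexp, Circle.coe_one, one_smul]

/-- The elements `h (U) V ^ l`, which span a dense subspace of `𝔸_α`. -/
def term (α : ℝ) (l : ℤ) : C(Circle, ℂ) →L[ℂ] NCTorus α :=
  (ContinuousLinearMap.mul ℂ (NCTorus α)).flip (V α ^ l : unitary (NCTorus α)) ∘L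
    starAlgHomCLM (circleCalculus (U α))

theorem term_apply (l : ℤ) (h : C(Circle, ℂ)) :
    term α l h = circleCalculus (U α) h * ((V α ^ l : unitary (NCTorus α)) : NCTorus α) := rfl

theorem term_zero (h : C(Circle, ℂ)) : term α 0 h = circleCalculus (U α) h := by
  simp [term_apply]

theorem term_one (l : ℤ) : term α l 1 = (V α ^ l : unitary (NCTorus α)) := by
  simp [term_apply]

theorem term_mul_term (h k : C(Circle, ℂ)) (l m : ℤ) :
    term α l h * term α m k = term α (l + m) (h * k.comp (circleRotation (-(l * α)))) := by
  have hcomm := unitary_mul_circleCalculus (V_zpow_mul_U (α := α) l) k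
  simp only [term_apply, map_mul, zpow_add, Submonoid.coe_mul, mul_assoc]
  simp only [← mul_assoc, hcomm]

theorem star_term (h : C(Circle, ℂ)) (l : ℤ) :
    star (term α l h) = term α (-l) ((star h).comp (circleRotation (l * α))) := by
  have hcomm := unitary_mul_circleCalculus (V_zpow_mul_U (α := α) (-l)) (star h)
  simp only [Int.cast_neg, neg_mul, neg_neg] at hcomm
  rw [term_apply, star_mul, ← map_star, ← Unitary.coe_star, Unitary.star_eq_inv, ← zpow_neg, hcomm,
    term_apply]

theorem star_term_mul_term (h k : C(Circle, ℂ)) (l m : ℤ) :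
    star (term α l h) * term α m k =
      term α (m - l) ((star h * k).comp (circleRotation (l * α))) := by
  rw [star_term, term_mul_term, neg_add_eq_sub]
  congr 1
  ext z
  simp

theorem exists_mk_mono_eq_term (g : FreeGroup Bool) :
    ∃ l h, mk (PreTorus.mono α g 1) = term α l h := by
  induction g using FreeGroup.induction_on with
  | C1 => exact ⟨0, 1, by rw [term_one, zpow_zero]; rfl⟩
  | of i =>
    cases i
    · exact ⟨1, 1, by rw [term_one, zpow_one]; rfl⟩
    · exact ⟨0, circleCoord, by rw [term_zero, circleCalculus_circleCoord]; rfl⟩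
  | inv_of i hi =>
    obtain ⟨l, h, hl⟩ := hi
    exact ⟨_, _, by rw [← star_term, ← hl, star_mk, PreTorus.star_mono, star_one]⟩
  | mul g g' hg hg' =>
    obtain ⟨l, h, hl⟩ := hg
    obtain ⟨m, k, hm⟩ := hg'
    refine ⟨_, _, Eq.trans ?_ (term_mul_term h k l m)⟩
    rw [← hl, ← hm, ← mk_mul, PreTorus.mono_mul_mono, mul_one]

theorem continuousLinearMap_ext_term {E : Type*} [NormedAddCommGroup E] [NormedSpace ℂ E]
    {F G : NCTorus α →L[ℂ] E} (hFG : ∀ l h, F (term α l h) = G (term α l h)) : F = G := by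
  have hmono : ∀ g c, F (mk (PreTorus.mono α g c)) = G (mk (PreTorus.mono α g c)) := by
    intro g c
    obtain ⟨l, h, hl⟩ := exists_mk_mono_eq_term (α := α) g
    rw [← mul_one c, ← PreTorus.smul_mono, mk_smul, hl, map_smul, map_smul, hFG]
  ext x
  induction x using induction with
  | hc => exact isClosed_eq F.continuous G.continuous
  | h x =>
    induction x using PreTorus.induction with
    | zero =>
      rw [← zero_smul ℂ (0 : PreTorus α), mk_smul, zero_smul, map_zero, map_zero]
    | add x y hx hy => rw [mk_add, map_add, map_add, hx, hy]
    | mono g c => exact hmono g c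

theorem trace_term (l : ℤ) (h : C(Circle, ℂ)) :
    trace α (term α l h) = if l = 0 then circleMean h else 0 := by
  have hcomp : trace α ∘L term α l = (if l = 0 then 1 else 0 : ℂ) • circleMean := by
    refine continuousLinearMap_circle_ext fun k => ?_
    rw [ContinuousLinearMap.comp_apply, term_apply, circleCalculus_circleCoord_zpow,
      trace_U_zpow_mul_V_zpow, smul_apply, circleMean_circleCoord_zpow]
    by_cases hk : k = 0 <;> by_cases hl : l = 0 <;> simp [hk, hl]
  have happly := DFunLike.congr_fun hcomp h
  rw [ContinuousLinearMap.comp_apply, smul_apply] at happly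
  rw [happly]
  split_ifs <;> simp

end NCTorus

/-- The functions `f_n` as continuous maps `𝕋 → 𝕋`; complex conjugation is inversion in `𝕋`. -/
def cocycleMap (α : ℝ) (f : C(Circle, Circle)) : ℤ → C(Circle, Circle)
  | Int.ofNat n => ∏ l ∈ Finset.range n, f.comp (circleRotation (-(l * α)))
  | Int.negSucc k => ∏ l ∈ Finset.Icc 1 (k + 1), (f.comp (circleRotation (l * α)))⁻¹

theorem coe_cocycleMap_apply (α : ℝ) (f : C(Circle, Circle)) (n : ℤ) (z : Circle) :
    (cocycleMap α f n z : ℂ) = cocycle α f n z := by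
  have hprod (s : Finset ℕ) (F : ℕ → C(Circle, Circle)) :
      ((∏ l ∈ s, F l) z : ℂ) = ∏ l ∈ s, (F l z : ℂ) := by
    rw [ContinuousMap.prod_apply]
    exact map_prod Circle.coeHom _ s
  cases n with
  | ofNat n => exact hprod _ _
  | negSucc k =>
    exact (hprod _ _).trans (Finset.prod_congr rfl fun l _ => Circle.coe_inv_eq_conj _)

theorem cocycleMap_zero (α : ℝ) (f : C(Circle, Circle)) : cocycleMap α f 0 = 1 :=
  Finset.prod_range_zero _

theorem cocycleMap_add_one (α : ℝ) (f : C(Circle, Circle)) (n : ℤ) :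
    cocycleMap α f (n + 1) = cocycleMap α f n * f.comp (circleRotation (-(n * α))) := by
  cases n with
  | ofNat n => exact Finset.prod_range_succ _ n
  | negSucc k =>
    have hsucc : cocycleMap α f (Int.negSucc k) =
        cocycleMap α f (Int.negSucc k + 1) * (f.comp (circleRotation ((k + 1 : ℕ) * α)))⁻¹ := by
      cases k <;> exact Finset.prod_Icc_succ_top (by lia) _
    rw [hsucc, Int.cast_negSucc, neg_mul, neg_neg, inv_mul_cancel_right]

theorem eq_zpow_of_add_one {G : Type*} [Group G] {a : ℤ → G} {w : G} (h_zero : a 0 = 1)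
    (h_add_one : ∀ n, a (n + 1) = a n * w) (n : ℤ) : a n = w ^ n := by
  induction n using Int.induction_on with
  | zero => rw [h_zero, zpow_zero]
  | succ k ih => rw [h_add_one, ih, zpow_add_one]
  | pred k ih => rw [zpow_sub_one, ← ih, eq_mul_inv_iff_mul_eq, ← h_add_one, sub_add_cancel]

namespace NCTorus

variable {α : ℝ}

theorem circleApply_mul_V_zpow (f : C(Circle, Circle)) (n : ℤ) :
    (((circleApply f (U α) * V α) ^ n : unitary (NCTorus α)) : NCTorus α) =
      term α n (circleUnitary (cocycleMap α f n)) := by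
  have hpow := eq_zpow_of_add_one (w := circleApply f (U α) * V α)
    (a := fun n => circleApply (cocycleMap α f n) (U α) * V α ^ n) ?_ ?_ n
  · rw [← hpow]
    rfl
  · rw [cocycleMap_zero, zpow_zero, mul_one]
    exact Subtype.ext (map_one (circleCalculus (U α)))
  · intro n
    ext
    have hmul := term_mul_term (α := α) (circleUnitary (cocycleMap α f n)) (circleUnitary f) n 1
    simp only [term_apply, zpow_one] at hmul
    rw [cocycleMap_add_one]
    exact hmul.symm

theorem anzai_circleCalculus (θ : ℝ) (f : C(Circle, Circle)) (h : C(Circle, ℂ)) :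
    anzai α θ f (circleCalculus (U α) h) =
      circleCalculus (U α) (h.comp (circleRotation (θ / (2 * Real.pi)))) := by
  have hU : anzai α θ f (U α) =
      rotateUnitary (Circle.exp (2 * Real.pi * (θ / (2 * Real.pi)))) (U α) := by
    rw [anzai_U, coe_rotateUnitary, mul_div_cancel₀ _ Real.two_pi_pos.ne']
  rw [map_circleCalculus _ hU, circleCalculus_rotateUnitary]

theorem anzai_V_zpow (θ : ℝ) (f : C(Circle, Circle)) (n : ℤ) :
    anzai α θ f (V α ^ n : unitary (NCTorus α)) =
      term α n (circleUnitary (cocycleMap α f n)) := by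
  rw [starAlgHom_unitary_zpow _ (b := circleApply f (U α) * V α) (anzai_V α θ f),
    circleApply_mul_V_zpow]

theorem anzai_term (θ : ℝ) (f : C(Circle, Circle)) (n : ℤ) (h : C(Circle, ℂ)) :
    anzai α θ f (term α n h) = term α n
      (h.comp (circleRotation (θ / (2 * Real.pi))) * circleUnitary (cocycleMap α f n)) := by
  rw [term_apply, map_mul, anzai_circleCalculus, anzai_V_zpow, term_apply, term_apply, map_mul,
    mul_assoc]

theorem anzai_term_zero (θ : ℝ) (f : C(Circle, Circle)) (h : C(Circle, ℂ)) :
    anzai α θ f (term α 0 h) = term α 0 (h.comp (circleRotation (θ / (2 * Real.pi)))) := by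
  rw [term_zero, anzai_circleCalculus, term_zero]

end NCTorus

section SquareIntegrable

variable {X : Type*} [TopologicalSpace X] [MeasurableSpace X] [OpensMeasurableSpace X]
  {μ : Measure X} {p : ENNReal}

theorem memLp_mul_unimodular (u : C(X, Circle)) (g : Lp ℂ p μ) :
    MemLp (fun x => g x * u x) p μ :=
  (Lp.memLp g).of_le
    ((Lp.aestronglyMeasurable g).mul
      (continuous_circle_coe.comp u.continuous).aestronglyMeasurable)
    (Filter.Eventually.of_forall fun x => by rw [norm_mul, Circle.norm_coe, mul_one])

variable (μ p) in
/-- Multiplication of `L^p` functions by a continuous function `X → 𝕋`, an isometry. -/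
def unimodularMul [Fact (1 ≤ p)] (u : C(X, Circle)) : Lp ℂ p μ →ₗᵢ[ℂ] Lp ℂ p μ where
  toFun g := (memLp_mul_unimodular u g).toLp
  map_add' g k := by
    rw [← MemLp.toLp_add]
    refine MemLp.toLp_congr _ _ ?_
    filter_upwards [Lp.coeFn_add g k] with x hx
    rw [hx, Pi.add_apply, Pi.add_apply, add_mul]
  map_smul' c g := by
    rw [RingHom.id_apply, ← MemLp.toLp_const_smul]
    refine MemLp.toLp_congr _ _ ?_
    filter_upwards [Lp.coeFn_smul c g] with x hx
    rw [hx, Pi.smul_apply, Pi.smul_apply, smul_mul_assoc]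
  norm_map' g := by
    change ‖(memLp_mul_unimodular u g).toLp‖ = ‖g‖
    rw [Lp.norm_toLp, Lp.norm_def]
    refine congrArg ENNReal.toReal (eLpNorm_congr_norm_ae (Filter.Eventually.of_forall fun x => ?_))
    rw [norm_mul, Circle.norm_coe, mul_one]

theorem coeFn_unimodularMul [Fact (1 ≤ p)] (u : C(X, Circle)) (g : Lp ℂ p μ) :
    unimodularMul μ p u g =ᵐ[μ] fun x => g x * u x :=
  MemLp.coeFn_toLp (memLp_mul_unimodular u g)

end SquareIntegrable

/-- The class in `L²(𝕋)` of a continuous function. -/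
def circleToL2 : C(Circle, ℂ) →L[ℂ] Lp ℂ 2 Circle.lebesgue :=
  ContinuousMap.toLp 2 Circle.lebesgue ℂ

theorem denseRange_circleToL2 : DenseRange circleToL2 :=
  ContinuousMap.toLp_denseRange ℂ Circle.lebesgue ℂ (by norm_num)

theorem coeFn_circleToL2 (h : C(Circle, ℂ)) : circleToL2 h =ᵐ[Circle.lebesgue] h :=
  ContinuousMap.coeFn_toLp _ h

theorem inner_circleToL2 (h k : C(Circle, ℂ)) :
    ⟪circleToL2 h, circleToL2 k⟫_ℂ = circleMean (star h * k) := by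
  rw [circleToL2, ContinuousMap.inner_toLp, circleMean_apply]
  exact integral_congr_ae (Filter.Eventually.of_forall fun z => mul_comm _ _)

/-- The isometry `g ↦ (g ∘ R_{θ / 2 π}) f_n` of `L²(𝕋)`, whose fixed vectors are the solutions of
the cohomological equation. -/
def cohomologicalIsometry (α θ : ℝ) (f : C(Circle, Circle)) (n : ℤ) :
    Lp ℂ 2 Circle.lebesgue →ₗᵢ[ℂ] Lp ℂ 2 Circle.lebesgue :=
  (unimodularMul Circle.lebesgue 2 (cocycleMap α f n)).comp
    (Lp.compMeasurePreservingₗᵢ ℂ (circleRotation (θ / (2 * Real.pi)))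
      (measurePreserving_circleRotation _))

section Cohomological

variable {α θ : ℝ} {f : C(Circle, Circle)} {n : ℤ}

theorem coeFn_cohomologicalIsometry (g : Lp ℂ 2 Circle.lebesgue) :
    cohomologicalIsometry α θ f n g =ᵐ[Circle.lebesgue]
      fun z => g (Circle.rot (θ / (2 * Real.pi)) z) * cocycle α f n z := by
  filter_upwards [coeFn_unimodularMul (cocycleMap α f n) (Lp.compMeasurePreserving _
      (measurePreserving_circleRotation (θ / (2 * Real.pi))) g),
    Lp.coeFn_compMeasurePreserving g (measurePreserving_circleRotation (θ / (2 * Real.pi)))]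
    with z hmul hcomp
  rw [← coe_cocycleMap_apply]
  refine hmul.trans ?_
  rw [hcomp, Function.comp_apply, circleRotation_apply]

theorem solvesCohomological_iff {g : Lp ℂ 2 Circle.lebesgue} :
    SolvesCohomological α θ f n g ↔ cohomologicalIsometry α θ f n g = g := by
  rw [Lp.ext_iff]
  exact ⟨fun h => (coeFn_cohomologicalIsometry g).trans h,
    fun h => (coeFn_cohomologicalIsometry g).symm.trans h⟩

theorem cohomologicalIsometry_circleToL2 (h : C(Circle, ℂ)) :
    cohomologicalIsometry α θ f n (circleToL2 h) =
      circleToL2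
        (h.comp (circleRotation (θ / (2 * Real.pi))) * circleUnitary (cocycleMap α f n)) := by
  rw [Lp.ext_iff]
  filter_upwards [coeFn_cohomologicalIsometry (circleToL2 h), coeFn_circleToL2
      (h.comp (circleRotation (θ / (2 * Real.pi))) * circleUnitary (cocycleMap α f n)),
    (measurePreserving_circleRotation (θ / (2 * Real.pi))).quasiMeasurePreserving.ae
      (coeFn_circleToL2 h)] with z hW hk hh
  rw [hW, hk, ← circleRotation_apply, hh, ContinuousMap.mul_apply, circleUnitary_apply,
    coe_cocycleMap_apply, ContinuousMap.comp_apply]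

end Cohomological

theorem linearIsometry_apply_eq_self {𝕜 H : Type*} [RCLike 𝕜] [NormedAddCommGroup H]
    [InnerProductSpace 𝕜 H] (W : H →ₗᵢ[𝕜] H) {x : H} (h : ⟪x, W x⟫_𝕜 = ⟪x, x⟫_𝕜) : W x = x := by
  rw [← sub_eq_zero, ← inner_self_eq_zero (𝕜 := 𝕜), inner_sub_left, inner_sub_right,
    inner_sub_right, W.inner_map_map, h, ← inner_conj_symm (W x) x, h, inner_conj_symm]
  ring

section States

variable {A : Type*} [CStarAlgebra A]

theorem norm_sq_apply_star_mul_le {φ : A →L[ℂ] ℂ} (hφ : ∀ a, 0 ≤ φ (star a * a))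
    (a b : A) :
    ‖φ (star a * b)‖ ^ 2 ≤ (φ (star a * a)).re * (φ (star b * b)).re := by
  let _ := CStarAlgebra.spectralOrder A
  have _ := CStarAlgebra.spectralOrderedRing A
  let φ₀ : A →ₚ[ℂ] ℂ := .mk₀ φ.toLinearMap fun x hx => by
    obtain ⟨y, rfl⟩ := CStarAlgebra.nonneg_iff_eq_star_mul_self.1 hx
    exact hφ y
  have hnorm (c : A) : ‖φ₀.toPreGNS c‖ ^ 2 = (φ (star c * c)).re := by
    rw [norm_sq_eq_re_inner (𝕜 := ℂ)]
    rfl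
  rw [← hnorm, ← hnorm, ← mul_pow]
  exact pow_le_pow_left₀ (norm_nonneg _)
    (norm_inner_le_norm (𝕜 := ℂ) (φ₀.toPreGNS a) (φ₀.toPreGNS b)) 2

theorem isErgodicState_of_isUniquelyErgodic {Φ : A →⋆ₐ[ℂ] A} {φ : A →L[ℂ] ℂ}
    (hφ : φ ∈ invariantStates Φ) (hΦ : IsUniquelyErgodic Φ) : IsErgodicState Φ φ :=
  ⟨hφ, fun _ h₁ _ _ _ => hΦ.unique h₁ hφ⟩

end States

namespace NCTorus

variable {α θ : ℝ} {f : C(Circle, Circle)}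

theorem trace_anzai (a : NCTorus α) : trace α (anzai α θ f a) = trace α a := by
  have h : (trace α).comp (starAlgHomCLM (anzai α θ f)) = trace α := by
    refine continuousLinearMap_ext_term fun n h => ?_
    change trace α (anzai α θ f (term α n h)) = _
    rcases eq_or_ne n 0 with rfl | hn
    · rw [anzai_term_zero, trace_term, trace_term, if_pos rfl, if_pos rfl,
        circleMean_comp_circleRotation]
    · rw [anzai_term, trace_term, trace_term, if_neg hn, if_neg hn]
  exact DFunLike.congr_fun h a

variable {φ : NCTorus α →L[ℂ] ℂ}

theorem term_zero_eq_circleMean (hθ : Irrational (θ / (2 * Real.pi)))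
    (hφ : φ ∈ invariantStates (anzai α θ f)) (h : C(Circle, ℂ)) :
    φ (term α 0 h) = circleMean h := by
  have hF : φ.comp (term α 0) = φ (term α 0 1) • circleMean := by
    refine eq_smul_circleMean_of_rotation_invariant hθ fun h => ?_
    have hinv := hφ.2 (term α 0 h)
    rw [anzai_term_zero] at hinv
    exact hinv
  rw [← ContinuousLinearMap.comp_apply, hF, term_one, zpow_zero, OneMemClass.coe_one, hφ.1.1,
    one_smul]

theorem norm_apply_term_le (hθ : Irrational (θ / (2 * Real.pi)))
    (hφ : φ ∈ invariantStates (anzai α θ f)) (n : ℤ) (h : C(Circle, ℂ)) :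
    ‖φ (term α n h)‖ ≤ ‖circleToL2 h‖ := by
  have hCS := norm_sq_apply_star_mul_le hφ.1.2 (term α 0 (star h))
    (V α ^ n : unitary (NCTorus α))
  have hterm : star (term α 0 (star h)) * (V α ^ n : unitary (NCTorus α)) = term α n h := by
    rw [term_zero, term_apply, ← map_star, star_star]
  have hnorm : (φ (star (term α 0 (star h)) * term α 0 (star h))).re = ‖circleToL2 h‖ ^ 2 := by
    rw [norm_sq_eq_re_inner (𝕜 := ℂ), inner_circleToL2, ← term_zero_eq_circleMean hθ hφ,
      term_zero, ← map_star, ← map_mul, star_star, mul_comm, term_zero]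
    rfl
  rw [hterm, hnorm, Unitary.coe_star_mul_self, hφ.1.1, Complex.one_re, mul_one] at hCS
  exact le_of_sq_le_sq hCS (norm_nonneg _)

theorem exists_apply_term_eq_inner (hθ : Irrational (θ / (2 * Real.pi)))
    (hφ : φ ∈ invariantStates (anzai α θ f)) (n : ℤ) :
    ∃ g : Lp ℂ 2 Circle.lebesgue, ∀ h, φ (term α n h) = ⟪g, circleToL2 h⟫_ℂ := by
  let ψ₀ := (φ.comp (term α n)).toLinearMap
  let ψ := ψ₀.extendOfNorm circleToL2.toLinearMap
  refine ⟨(InnerProductSpace.toDual ℂ _).symm ψ, fun h => ?_⟩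
  rw [InnerProductSpace.toDual_symm_apply]
  exact (ψ₀.extendOfNorm_eq denseRange_circleToL2
    ⟨1, fun h => (norm_apply_term_le hθ hφ n h).trans_eq (one_mul _).symm⟩ h).symm

theorem eq_trace_of_forall_not_solvesCohomological (hθ : Irrational (θ / (2 * Real.pi)))
    (hf : ∀ n : ℤ, n ≠ 0 → ¬ ∃ g : Lp ℂ 2 Circle.lebesgue, g ≠ 0 ∧ SolvesCohomological α θ f n g)
    (hφ : φ ∈ invariantStates (anzai α θ f)) : φ = trace α := by
  refine continuousLinearMap_ext_term fun n h => ?_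
  rw [trace_term]
  split_ifs with hn
  · rw [hn, term_zero_eq_circleMean hθ hφ]
  obtain ⟨g, hg⟩ := exists_apply_term_eq_inner hθ hφ n
  have hinv : ∀ y, ⟪g, cohomologicalIsometry α θ f n y⟫_ℂ = ⟪g, y⟫_ℂ := fun y =>
    denseRange_circleToL2.induction_on y (isClosed_eq (by fun_prop) (by fun_prop)) fun h => by
      rw [cohomologicalIsometry_circleToL2, ← hg, ← hg, ← anzai_term, hφ.2]
  have hsolves : SolvesCohomological α θ f n g :=
    solvesCohomological_iff.2 (linearIsometry_apply_eq_self _ (hinv g))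
  have hzero : g = 0 := not_not.1 fun h0 => hf n hn ⟨g, h0, hsolves⟩
  rw [hg, hzero, inner_zero_left]

end NCTorus

section VectorFunctionals

variable {A H : Type*} [CStarAlgebra A] [NormedAddCommGroup H] [InnerProductSpace ℂ H]
  [CompleteSpace H]

/-- The coefficient functional `a ↦ ⟨x, π (a) y⟩` of a representation `π`. -/
def vectorFunctional (π : A →⋆ₐ[ℂ] (H →L[ℂ] H)) (x y : H) : A →L[ℂ] ℂ :=
  innerSL ℂ x ∘L ContinuousLinearMap.apply ℂ H y ∘L starAlgHomCLM π

variable (π : A →⋆ₐ[ℂ] (H →L[ℂ] H)) {Φ : A →⋆ₐ[ℂ] A}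

theorem vectorFunctional_apply (x y : H) (a : A) : vectorFunctional π x y a = ⟪x, π a y⟫_ℂ := rfl

theorem vectorFunctional_star_mul (x y : H) (a b : A) :
    vectorFunctional π x y (star a * b) = ⟪π a x, π b y⟫_ℂ := by
  rw [vectorFunctional_apply, map_mul, map_star, ContinuousLinearMap.star_eq_adjoint,
    mul_apply_eq_comp, ContinuousLinearMap.adjoint_inner_right]

theorem vectorFunctional_star (x y : H) (a : A) :
    vectorFunctional π x y (star a) = conj (vectorFunctional π y x a) := by
  have h := vectorFunctional_star_mul π x y a 1
  rw [mul_one, map_one, one_apply_eq_self] at h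
  rw [h, vectorFunctional_apply, inner_conj_symm]

theorem vectorFunctional_self_nonneg (x : H) (a : A) :
    0 ≤ vectorFunctional π x x (star a * a) := by
  rw [vectorFunctional_star_mul, inner_self_eq_norm_sq_to_K]
  positivity

theorem vectorFunctional_self_mem_states {ξ : H} (hξ : ‖ξ‖ = 1) :
    vectorFunctional π ξ ξ ∈ states A := by
  refine ⟨?_, vectorFunctional_self_nonneg π ξ⟩
  rw [vectorFunctional_apply, map_one, one_apply_eq_self, inner_self_eq_norm_sq_to_K, hξ]
  simp

theorem IsErgodicState.eq_zero_of_add_mem_of_sub_mem {φ ψ : A →L[ℂ] ℂ} (hφ : IsErgodicState Φ φ)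
    (h_add : φ + ψ ∈ invariantStates Φ) (h_sub : φ - ψ ∈ invariantStates Φ) : ψ = 0 := by
  refine left_eq_add.1 (hφ.2 h_add h_sub ⟨2⁻¹, 2⁻¹, by norm_num, by norm_num, by norm_num, ?_⟩).symm
  module

variable {π} {ξ x : H}

theorem vectorFunctional_add_mem_invariantStates (hξ : vectorFunctional π ξ ξ ∈ invariantStates Φ)
    (hx : vectorFunctional π x x = ‖x‖ ^ 2 • vectorFunctional π ξ ξ) (hxξ : ⟪x, ξ⟫_ℂ = 0)
    (hinv : ∀ a, vectorFunctional π x ξ (Φ a) = vectorFunctional π x ξ a) :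
    vectorFunctional π ξ ξ + (1 + ‖x‖ ^ 2)⁻¹ •
      (vectorFunctional π x ξ + vectorFunctional π ξ x) ∈ invariantStates Φ := by
  have hinv' (a : A) : vectorFunctional π ξ x (Φ a) = vectorFunctional π ξ x a := by
    rw [← star_star a, map_star, vectorFunctional_star, hinv, ← vectorFunctional_star]
  have hsum : vectorFunctional π ξ ξ + (1 + ‖x‖ ^ 2)⁻¹ •
      (vectorFunctional π x ξ + vectorFunctional π ξ x) =
        (1 + ‖x‖ ^ 2)⁻¹ • vectorFunctional π (ξ + x) (ξ + x) := by
    have hexpand : vectorFunctional π (ξ + x) (ξ + x) = vectorFunctional π ξ ξ +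
        (vectorFunctional π x ξ + vectorFunctional π ξ x) + vectorFunctional π x x := by
      ext a
      simp only [add_apply, vectorFunctional_apply, inner_add_left, inner_add_right, map_add]
      ring
    have hpos : (1 + ‖x‖ ^ 2) ≠ 0 := by positivity
    rw [hexpand, hx]
    match_scalars <;> field_simp
  refine ⟨⟨?_, fun a => ?_⟩, fun a => ?_⟩
  · simp [hξ.1.1, vectorFunctional_apply π x ξ, vectorFunctional_apply π ξ x, hxξ,
      inner_eq_zero_symm.1 hxξ]
  · rw [hsum]
    exact smul_nonneg (a := (1 + ‖x‖ ^ 2)⁻¹) (by positivity) (vectorFunctional_self_nonneg π _ a)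
  · simp only [add_apply, smul_apply, hξ.2, hinv, hinv']

theorem vectorFunctional_add_eq_zero (hξ : IsErgodicState Φ (vectorFunctional π ξ ξ))
    (hx : vectorFunctional π x x = ‖x‖ ^ 2 • vectorFunctional π ξ ξ) (hxξ : ⟪x, ξ⟫_ℂ = 0)
    (hinv : ∀ a, vectorFunctional π x ξ (Φ a) = vectorFunctional π x ξ a) :
    vectorFunctional π x ξ + vectorFunctional π ξ x = 0 := by
  have hadd := vectorFunctional_add_mem_invariantStates hξ.1 hx hxξ hinv
  have hneg : vectorFunctional π (-x) ξ + vectorFunctional π ξ (-x) =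
      -(vectorFunctional π x ξ + vectorFunctional π ξ x) := by
    ext a
    simp [vectorFunctional_apply, add_comm]
  have hsub := vectorFunctional_add_mem_invariantStates (x := -x) hξ.1
    (by rw [norm_neg, ← hx]; ext a; simp [vectorFunctional_apply])
    (by rw [inner_neg_left, hxξ, neg_zero])
    (fun a => by simpa [vectorFunctional_apply] using hinv a)
  rw [hneg, norm_neg, smul_neg, ← sub_eq_add_neg] at hsub
  have hpos : (1 + ‖x‖ ^ 2)⁻¹ ≠ 0 := by positivity
  exact (smul_eq_zero.1 (hξ.eq_zero_of_add_mem_of_sub_mem hadd hsub)).resolve_left hpos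

theorem vectorFunctional_eq_zero_of_isErgodicState
    (hξ : IsErgodicState Φ (vectorFunctional π ξ ξ))
    (hx : vectorFunctional π x x = ‖x‖ ^ 2 • vectorFunctional π ξ ξ) (hxξ : ⟪x, ξ⟫_ℂ = 0)
    (hinv : ∀ a, vectorFunctional π x ξ (Φ a) = vectorFunctional π x ξ a) :
    vectorFunctional π x ξ = 0 := by
  have hre := vectorFunctional_add_eq_zero hξ hx hxξ hinv
  have him := vectorFunctional_add_eq_zero (x := Complex.I • x) hξ
    (by
      rw [norm_smul, Complex.norm_I, one_mul, ← hx]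
      ext a
      simp only [vectorFunctional_apply, map_smul, inner_smul_left, inner_smul_right,
        Complex.conj_I]
      linear_combination -⟪x, π a x⟫_ℂ * Complex.I_sq)
    (by rw [inner_smul_left, hxξ, mul_zero])
    (fun a => by simpa [vectorFunctional_apply, inner_smul_left] using hinv a)
  ext a
  have hre_a := DFunLike.congr_fun hre a
  have him_a := DFunLike.congr_fun him a
  simp only [add_apply, vectorFunctional_apply, inner_smul_left, inner_smul_right, map_smul,
    Complex.conj_I, zero_apply] at hre_a him_a ⊢
  linear_combination (1 / 2) * hre_a + (Complex.I / 2) * him_a +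
    (1 / 2) * (⟪x, π a ξ⟫_ℂ - ⟪ξ, π a x⟫_ℂ) * Complex.I_sq

end VectorFunctionals

namespace NCTorus

/-- The cyclic vector `ξ = δ_{0, 0}` of the regular representation, which implements the trace. -/
def traceVector : EllTwo := lp.single 2 (0, 0) 1

theorem norm_traceVector : ‖traceVector‖ = 1 := by simp [traceVector]

theorem trace_eq_vectorFunctional (α : ℝ) :
    trace α = vectorFunctional (regularRep α) traceVector traceVector := rfl

theorem trace_mem_invariantStates (α θ : ℝ) (f : C(Circle, Circle)) :
    trace α ∈ invariantStates (anzai α θ f) :=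
  ⟨vectorFunctional_self_mem_states (regularRep α) norm_traceVector, trace_anzai⟩

variable {α θ : ℝ} {f : C(Circle, Circle)} {n : ℤ}

theorem inner_regularRep_traceVector (a b : NCTorus α) :
    ⟪regularRep α a traceVector, regularRep α b traceVector⟫_ℂ = trace α (star a * b) := by
  rw [trace_eq_vectorFunctional, vectorFunctional_star_mul]

theorem inner_regularRep_term_traceVector (l m : ℤ) (h k : C(Circle, ℂ)) :
    ⟪regularRep α (term α l h) traceVector, regularRep α (term α m k) traceVector⟫_ℂ =
      if m = l then ⟪circleToL2 h, circleToL2 k⟫_ℂ else 0 := by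
  simp only [inner_regularRep_traceVector, star_term_mul_term, trace_term,
    circleMean_comp_circleRotation, inner_circleToL2, sub_eq_zero]

variable (α n) in
/-- The map `L²(𝕋) → ℓ²(ℤ × ℤ)` with `h ↦ h (U) V^n ξ`: the `n`-th summand of the decomposition
of the GNS space of the trace as `⨁ₙ L²(𝕋)`. -/
def embedL2 : Lp ℂ 2 Circle.lebesgue →L[ℂ] EllTwo :=
  (ContinuousLinearMap.apply ℂ EllTwo traceVector ∘L starAlgHomCLM (regularRep α) ∘L
    term α n).toLinearMap.extendOfNorm circleToL2.toLinearMap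

theorem embedL2_circleToL2 (h : C(Circle, ℂ)) :
    embedL2 α n (circleToL2 h) = regularRep α (term α n h) traceVector := by
  refine LinearMap.extendOfNorm_eq denseRange_circleToL2 ⟨1, fun k => ?_⟩ h
  change ‖regularRep α (term α n k) traceVector‖ ≤ 1 * ‖circleToL2 k‖
  rw [one_mul, norm_eq_sqrt_re_inner (𝕜 := ℂ), norm_eq_sqrt_re_inner (𝕜 := ℂ),
    inner_regularRep_term_traceVector, if_pos rfl]

theorem embedL2_cohomologicalIsometry_circleToL2 (h : C(Circle, ℂ)) :
    embedL2 α n (cohomologicalIsometry α θ f n (circleToL2 h)) =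
      regularRep α (anzai α θ f (term α n h)) traceVector := by
  rw [cohomologicalIsometry_circleToL2, embedL2_circleToL2, anzai_term]

variable (g : Lp ℂ 2 Circle.lebesgue)

theorem inner_embedL2_regularRep_term_traceVector (m : ℤ) (h : C(Circle, ℂ)) :
    ⟪embedL2 α n g, regularRep α (term α m h) traceVector⟫_ℂ =
      if m = n then ⟪g, circleToL2 h⟫_ℂ else 0 := by
  induction g using denseRange_circleToL2.induction_on with
  | hp => split_ifs <;> exact isClosed_eq (by fun_prop) (by fun_prop)
  | ih k => rw [embedL2_circleToL2, inner_regularRep_term_traceVector]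

theorem inner_embedL2_traceVector (hn : n ≠ 0) : ⟪embedL2 α n g, traceVector⟫_ℂ = 0 := by
  have h := inner_embedL2_regularRep_term_traceVector (α := α) (n := n) g 0 1
  rwa [term_zero, map_one, map_one, one_apply_eq_self, if_neg hn.symm] at h

theorem vectorFunctional_embedL2_cohomologicalIsometry_traceVector (a : NCTorus α) :
    vectorFunctional (regularRep α) (embedL2 α n (cohomologicalIsometry α θ f n g)) traceVector
        (anzai α θ f a) =
      vectorFunctional (regularRep α) (embedL2 α n g) traceVector a := by
  simp only [vectorFunctional_apply]
  induction g using denseRange_circleToL2.induction_on with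
  | hp => exact isClosed_eq (by fun_prop) (by fun_prop)
  | ih k => rw [embedL2_cohomologicalIsometry_circleToL2, embedL2_circleToL2,
      inner_regularRep_traceVector, inner_regularRep_traceVector, ← map_star, ← map_mul,
      trace_anzai]

theorem vectorFunctional_embedL2_cohomologicalIsometry (a : NCTorus α) :
    vectorFunctional (regularRep α) (embedL2 α n (cohomologicalIsometry α θ f n g))
        (embedL2 α n (cohomologicalIsometry α θ f n g)) (anzai α θ f a) =
      vectorFunctional (regularRep α) (embedL2 α n g) (embedL2 α n g) a := by
  simp only [vectorFunctional_apply]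
  induction g using denseRange_circleToL2.induction_on with
  | hp => exact isClosed_eq (by fun_prop) (by fun_prop)
  | ih k => rw [embedL2_cohomologicalIsometry_circleToL2, embedL2_circleToL2,
      ← mul_apply_eq_comp, ← mul_apply_eq_comp, ← map_mul, ← map_mul, ← map_mul,
      inner_regularRep_traceVector, inner_regularRep_traceVector, ← map_star, ← map_mul,
      trace_anzai]

theorem vectorFunctional_embedL2_term_eq_zero {l : ℤ} (hl : l ≠ 0) (h : C(Circle, ℂ)) :
    vectorFunctional (regularRep α) (embedL2 α n g) (embedL2 α n g) (term α l h) = 0 := by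
  rw [vectorFunctional_apply]
  induction g using denseRange_circleToL2.induction_on with
  | hp => exact isClosed_eq (by fun_prop) (by fun_prop)
  | ih k =>
    rw [embedL2_circleToL2, ← mul_apply_eq_comp, ← map_mul, term_mul_term,
      inner_regularRep_term_traceVector, if_neg (by simpa using hl)]

variable {g}

theorem vectorFunctional_embedL2_eq_smul_trace (hθ : Irrational (θ / (2 * Real.pi)))
    (hg : SolvesCohomological α θ f n g) :
    vectorFunctional (regularRep α) (embedL2 α n g) (embedL2 α n g) =
      ‖embedL2 α n g‖ ^ 2 • trace α := by
  have hW := solvesCohomological_iff.1 hg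
  let φ := vectorFunctional (regularRep α) (embedL2 α n g) (embedL2 α n g)
  have hinv (a : NCTorus α) : φ (anzai α θ f a) = φ a := by
    have h := vectorFunctional_embedL2_cohomologicalIsometry (θ := θ) (f := f) (n := n) g a
    rwa [hW] at h
  have hrot (h : C(Circle, ℂ)) : (φ.comp (term α 0)) (h.comp (circleRotation (θ / (2 * Real.pi)))) =
      (φ.comp (term α 0)) h := by
    rw [ContinuousLinearMap.comp_apply, ← anzai_term_zero θ f, hinv, ContinuousLinearMap.comp_apply]
  have hone : φ (term α 0 1) = ‖embedL2 α n g‖ ^ 2 := by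
    rw [term_zero, map_one, vectorFunctional_apply, map_one, one_apply_eq_self,
      inner_self_eq_norm_sq_to_K]
    rfl
  refine continuousLinearMap_ext_term fun l h => ?_
  rw [smul_apply, trace_term]
  rcases eq_or_ne l 0 with rfl | hl
  · have hmean := DFunLike.congr_fun (eq_smul_circleMean_of_rotation_invariant hθ hrot) h
    rw [ContinuousLinearMap.comp_apply, smul_apply, ContinuousLinearMap.comp_apply, hone] at hmean
    rw [if_pos rfl, hmean, smul_eq_mul, Complex.real_smul, Complex.ofReal_pow]
  · rw [if_neg hl, smul_zero, vectorFunctional_embedL2_term_eq_zero g hl]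

theorem eq_zero_of_isErgodicState_trace (hθ : Irrational (θ / (2 * Real.pi)))
    (htrace : IsErgodicState (anzai α θ f) (trace α)) (hn : n ≠ 0)
    (hg : SolvesCohomological α θ f n g) : g = 0 := by
  have hW := solvesCohomological_iff.1 hg
  have hzero : vectorFunctional (regularRep α) (embedL2 α n g) traceVector = 0 :=
    vectorFunctional_eq_zero_of_isErgodicState htrace
      (vectorFunctional_embedL2_eq_smul_trace hθ hg) (inner_embedL2_traceVector g hn) fun a => by
        have h := vectorFunctional_embedL2_cohomologicalIsometry_traceVector (θ := θ) (f := f)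
          (n := n) g a
        rwa [hW] at h
  refine denseRange_circleToL2.eq_zero_of_inner_left ℂ fun h => ?_
  have hinner := inner_embedL2_regularRep_term_traceVector (α := α) (n := n) g n h
  rw [if_pos rfl] at hinner
  rw [← hinner, ← vectorFunctional_apply, hzero, zero_apply]

end NCTorus

end

theorem mainTheorem4 (α θ : ℝ) (hθ : Irrational (θ / (2 * Real.pi))) (f : C(Circle, Circle)) :
    List.TFAE [
      IsErgodicState (NCTorus.anzai α θ f) (NCTorus.trace α),
      ∀ n : ℤ, n ≠ 0 → ¬ ∃ g : MeasureTheory.Lp ℂ 2 Circle.lebesgue,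
        g ≠ 0 ∧ SolvesCohomological α θ f n g,
      IsUniquelyErgodic (NCTorus.anzai α θ f)] := by
  tfae_have 1 → 2 := fun htrace _ hn ⟨_, hg, hsolves⟩ =>
    hg (NCTorus.eq_zero_of_isErgodicState_trace hθ htrace hn hsolves)
  tfae_have 2 → 3 := fun hf => ⟨NCTorus.trace α, NCTorus.trace_mem_invariantStates α θ f,
    fun _ hφ => NCTorus.eq_trace_of_forall_not_solvesCohomological hθ hf hφ⟩
  tfae_have 3 → 1 :=
    isErgodicState_of_isUniquelyErgodic (NCTorus.trace_mem_invariantStates α θ f)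
  tfae_finish
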